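/- Let $F\in\mathbb C[x,y,z]$ be an irreducible homogeneous polynomial of degree $d\ge 2$ and let $\mathcal C=V(F)\subset\mathbb P^2=\mathbb P^2(\mathbb C)$. For $S=[x_0:y_0:z_0]\in\mathbb P^2$ put $$\Delta_SF=x_0F_x+y_0F_y+z_0F_z,\qquad \sigma_S=(F_x^2+F_y^2)\,(x_0,y_0,z_0)-2\,\Delta_SF\,(F_x,F_y,0),$$ so that, for $m\in\mathcal C$ with $F_x^2+F_y^2\neq0$ at $m$, $\sigma_S(m)$ represents the image of $S$ under the orthogonal symmetry with respect to the tangent line to $\mathcal C$ at $m$. Let $\rho_{F,S}$ be the rational map $$\rho_{F,S}=(x,y,z)\wedge\sigma_S ,$$ which sends $m$ to (the coefficients of) the reflected line $\mathcal R_{m,S,\mathcal C}=(m\,\sigma_S(m))$, and let the caustic map $\Phi_{F,S}$ be the rational map on $\mathcal C$ which sends $m$ to the point at which $\mathcal R_{m,S,\mathcal C}$ touches the envelope of the reflected lines, that is $$\Phi_{F,S}=\rho_{F,S}\wedge\bigl(F_x\,\partial_y\rho_{F,S}-F_y\,\partial_x\rho_{F,S}\bigr).$$ Then, for a generic $S\in\mathbb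 P^2$, both $\rho_{F,S}$ and $\Phi_{F,S}$ are birational on $\mathcal C$. That is, there is an algebraic curve $\mathcal B\subset\mathbb P^2$ such that for every $S\in\mathbb P^2\setminus\mathcal B$ the restriction to $\mathcal C$ of each of the rational maps $\rho_{F,S}$ and $\Phi_{F,S}$ is a birational map from $\mathcal C$ onto the Zariski closure of its image. -/

import Mathlib

open MvPolynomial
open scoped Matrix LinearAlgebra.Projectivization

/-- The complex projective plane. -/
abbrev P2 : Type := ℙ ℂ (Fin 3 → ℂ)

/-- Polynomials in the homogeneous coordinates `x = X 0`, `y = X 1`, `z = X 2`. -/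
abbrev Poly3 : Type := MvPolynomial (Fin 3) ℂ

/-- `V(G)`, for a homogeneous polynomial `G` (the choice of representative is then irrelevant). -/
def projZeroLocus (G : Poly3) : Set P2 := {p | eval p.rep G = 0}

/-- The Zariski closure of a set of points: the common zeros of all homogeneous polynomials
vanishing on it. -/
def zariskiClosure (A : Set P2) : Set P2 :=
  {p | ∀ (n : ℕ) (G : Poly3), G.IsHomogeneous n → A ⊆ projZeroLocus G → p ∈ projZeroLocus G}

/-- Algebraic subsets of the plane. -/
def IsZariskiClosed (A : Set P2) : Prop := zariskiClosure A = A

/-- A rational map of the plane to itself, given by three forms of the same degree. -/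
structure PlaneRatMap where
  coord : Fin 3 → Poly3
  deg : ℕ
  homogeneous : ∀ i, (coord i).IsHomogeneous deg

/-- `f.Sends p q`: the three forms do not all vanish at `p`, and their values are
homogeneous coordinates of `q`. -/
def PlaneRatMap.Sends (f : PlaneRatMap) (p q : P2) : Prop :=
  ∃ h : (fun i => eval p.rep (f.coord i)) ≠ 0,
    Projectivization.mk ℂ (fun i => eval p.rep (f.coord i)) h = q

/-- The Zariski closure of the image of `A`. -/
def PlaneRatMap.closedImage (f : PlaneRatMap) (A : Set P2) : Set P2 :=
  zariskiClosure {q | ∃ p ∈ A, f.Sends p q}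

/-- For an irreducible algebraic set `A`, the rational map `f` restricts to a birational map from
`A` onto the closure `D` of its image: there are a rational map `g` and nonempty Zariski open
subsets `A \ Z` of `A` and `D \ W` of `D` between which `f` and `g` are mutually inverse. -/
def PlaneRatMap.IsBirationalOn (f : PlaneRatMap) (A : Set P2) : Prop :=
  ∃ (g : PlaneRatMap) (Z W : Set P2), IsZariskiClosed Z ∧ IsZariskiClosed W ∧
    (A \ Z).Nonempty ∧ (f.closedImage A \ W).Nonempty ∧
    (∀ p ∈ A \ Z, ∃ q ∈ f.closedImage A \ W, f.Sends p q ∧ g.Sends q p) ∧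
    (∀ q ∈ f.closedImage A \ W, ∃ p ∈ A \ Z, g.Sends q p ∧ f.Sends p q)

/-- The orthogonal symmetry with respect to the line `a₀ x + a₁ y + a₂ z = 0`, in homogeneous
coordinates: `(a₀² + a₁²) s - 2 (a₀ s₀ + a₁ s₁ + a₂ s₂) (a₀, a₁, 0)`. -/
def orthSymm {R : Type*} [CommRing R] (a s : Fin 3 → R) : Fin 3 → R :=
  (a 0 ^ 2 + a 1 ^ 2) • s - (2 * (a ⬝ᵥ s)) • ![a 0, a 1, 0]

/-- The gradient of `F`: the coefficients of the tangent line to `V(F)`. -/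
noncomputable def gradPoly (F : Poly3) : Fin 3 → Poly3 := fun i => pderiv i F

/-- The coefficients of the reflected line, that is, the line through `m = [x : y : z]` and the
image of the light position `s` under the orthogonal symmetry in the tangent to `V(F)` at `m`. -/
noncomputable def rhoCoord (F : Poly3) (s : Fin 3 → ℂ) : Fin 3 → Poly3 :=
  (X : Fin 3 → Poly3) ⨯₃ orthSymm (gradPoly F) (fun i => C (s i))

/-- Differentiation along `V(F)` in the affine chart `z = 1`: the tangent vector is
`(-F_y, F_x)`. -/
noncomputable def tangentDeriv (F H : Poly3) : Poly3 :=
  pderiv 0 F * pderiv 1 H - pderiv 1 F * pderiv 0 H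

/-- The point where the reflected line touches the envelope of the reflected lines: the
intersection of the reflected line with its derivative along the curve. -/
noncomputable def phiCoord (F : Poly3) (s : Fin 3 → ℂ) : Fin 3 → Poly3 :=
  rhoCoord F s ⨯₃ (fun i => tangentDeriv F (rhoCoord F s i))

theorem isHomogeneous_cross {u v : Fin 3 → Poly3} {m n : ℕ} (hu : ∀ i, (u i).IsHomogeneous m)
    (hv : ∀ i, (v i).IsHomogeneous n) (i : Fin 3) : ((u ⨯₃ v) i).IsHomogeneous (m + n) := by
  rw [cross_apply]
  fin_cases i
  · exact ((hu 1).mul (hv 2)).sub ((hu 2).mul (hv 1))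
  · exact ((hu 2).mul (hv 0)).sub ((hu 0).mul (hv 2))
  · exact ((hu 0).mul (hv 1)).sub ((hu 1).mul (hv 0))

theorem isHomogeneous_orthSymm {F : Poly3} {d : ℕ} (hF : F.IsHomogeneous d) (s : Fin 3 → ℂ)
    (i : Fin 3) :
    (orthSymm (gradPoly F) (fun i => C (s i)) i).IsHomogeneous ((d - 1) + (d - 1)) := by
  have hg : ∀ j, (gradPoly F j).IsHomogeneous (d - 1) := fun j => hF.pderiv
  have hs : ∀ j, (C (s j) : Poly3).IsHomogeneous 0 := fun j => isHomogeneous_C _ _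
  have h2 : (2 : Poly3).IsHomogeneous 0 := isHomogeneous_C _ (2 : ℂ)
  have hn : ∀ j, ((![gradPoly F 0, gradPoly F 1, 0] : Fin 3 → Poly3) j).IsHomogeneous (d - 1) := by
    intro j
    fin_cases j
    · exact hg 0
    · exact hg 1
    · exact isHomogeneous_zero _ _ _
  have hd : (gradPoly F ⬝ᵥ fun i => C (s i)).IsHomogeneous (d - 1) :=
    IsHomogeneous.sum _ _ _ fun j _ => (hg j).mul (hs j)
  have h1 : (gradPoly F 0 ^ 2 + gradPoly F 1 ^ 2).IsHomogeneous ((d - 1) + (d - 1)) := by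
    rw [sq, sq]
    exact ((hg 0).mul (hg 0)).add ((hg 1).mul (hg 1))
  have h3 := (h2.mul hd).mul (hn i)
  rw [zero_add] at h3
  exact (h1.mul (hs i)).sub h3

theorem isHomogeneous_rhoCoord {F : Poly3} {d : ℕ} (hF : F.IsHomogeneous d) (s : Fin 3 → ℂ)
    (i : Fin 3) : (rhoCoord F s i).IsHomogeneous (1 + ((d - 1) + (d - 1))) :=
  isHomogeneous_cross (fun j => isHomogeneous_X _ j) (isHomogeneous_orthSymm hF s) i

/-- The map `ρ_{F,s}`, sending a point of `V(F)` to the reflected line (the line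
`a x + b y + c z = 0` being regarded as the point `[a : b : c]`). -/
noncomputable def rhoMap (F : Poly3) {d : ℕ} (hF : F.IsHomogeneous d) (s : Fin 3 → ℂ) :
    PlaneRatMap where
  coord := rhoCoord F s
  deg := 1 + ((d - 1) + (d - 1))
  homogeneous := isHomogeneous_rhoCoord hF s

/-- The caustic map `Φ_{F,s}`. -/
noncomputable def phiMap (F : Poly3) {d : ℕ} (hF : F.IsHomogeneous d) (s : Fin 3 → ℂ) :
    PlaneRatMap where
  coord := phiCoord F s
  deg := (1 + ((d - 1) + (d - 1))) + ((d - 1) + (1 + ((d - 1) + (d - 1)) - 1))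
  homogeneous := isHomogeneous_cross (isHomogeneous_rhoCoord hF s) fun i =>
    (hF.pderiv.mul (isHomogeneous_rhoCoord hF s i).pderiv).sub
      (hF.pderiv.mul (isHomogeneous_rhoCoord hF s i).pderiv)

/-!
Let the light `S` be indeterminate. The reflected lines then satisfy a relation `H (S, Y) = 0` of
minimal degree in `Y`. Differentiating `H (S, ρ) = 0` with respect to `S`, with `m` fixed, gives
`∂_S H + σᵀ (∂_Y H) = 0`, where `σᵀ` is the transpose of `S ↦ m ∧ σ_S (m)`. Since `m` is fixed
by the reflection, it is orthogonal to `∂_S H (S, ρ)`; being orthogonal to `ρ` as well, it is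
proportional to `ρ ∧ ∂_S H (S, ρ)`. This recovers `m` rationally from the line `ρ`, and
specialises to generic `S`.

For `Φ` the argument is biduality: if the coordinates of `ρ` are linearly independent, the
reflected line is the tangent at `Φ` to the caustic, hence is the gradient at `Φ` of the minimal
relation of the caustic, so `Φ` determines `ρ`, which determines `m`. Linear independence for one,
hence for generic, `S` is seen by placing the light on tangents of the curve: at the point of
contact the reflected line is the tangent itself.
-/

section CrossProduct

variable {A B : Type*} [CommRing A] [CommRing B]

theorem smul_eq_smul_of_cross_eq_zero {u v : Fin 3 → A} (h : u ⨯₃ v = 0) (i : Fin 3) :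
    v i • u = u i • v := by
  have hi := cross_cross_eq_smul_sub_smul u v (Pi.single i 1)
  rw [h, map_zero, LinearMap.zero_apply, dotProduct_single_one, dotProduct_single_one] at hi
  exact (sub_eq_zero.1 hi.symm).symm

theorem cross_eq_zero_comm {u v : Fin 3 → A} : u ⨯₃ v = 0 ↔ v ⨯₃ u = 0 := by
  rw [← cross_anticomm, neg_eq_zero]

theorem map_comp_cross {Φ : Type*} [FunLike Φ A B] [RingHomClass Φ A B] (φ : Φ)
    (u v : Fin 3 → A) : φ ∘ (u ⨯₃ v) = (φ ∘ u) ⨯₃ (φ ∘ v) := by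
  ext i
  fin_cases i <;> simp [cross_apply]

theorem derivation_dotProduct {k : Type*} [CommRing k] [Algebra k A] (D : Derivation k A A)
    (u v : Fin 3 → A) : D (u ⬝ᵥ v) = (D ∘ u) ⬝ᵥ v + u ⬝ᵥ (D ∘ v) := by
  simp only [dotProduct, Fin.sum_univ_three, map_add, Derivation.leibniz, smul_eq_mul,
    Function.comp_apply]
  ring

theorem derivation_comp_cross {k : Type*} [CommRing k] [Algebra k A] (D : Derivation k A A)
    (u v : Fin 3 → A) : D ∘ (u ⨯₃ v) = (D ∘ u) ⨯₃ v + u ⨯₃ (D ∘ v) := by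
  ext i
  fin_cases i <;> simp [cross_apply] <;> ring

variable [IsDomain A]

theorem dotProduct_eq_zero_of_cross_eq_zero {u v w : Fin 3 → A} (hw : w ≠ 0) (hu : w ⨯₃ u = 0)
    (hv : w ⬝ᵥ v = 0) : u ⬝ᵥ v = 0 := by
  obtain ⟨i, hi⟩ := Function.ne_iff.1 hw
  refine (mul_eq_zero.1 ?_).resolve_left hi
  rw [← smul_eq_mul, ← smul_dotProduct, ← smul_eq_smul_of_cross_eq_zero hu, smul_dotProduct, hv,
    smul_zero]

theorem cross_eq_zero_trans {u v w : Fin 3 → A} (hv : v ≠ 0) (huv : u ⨯₃ v = 0)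
    (hvw : v ⨯₃ w = 0) : u ⨯₃ w = 0 := by
  obtain ⟨i, hi⟩ := Function.ne_iff.1 hv
  refine (smul_eq_zero.1 ?_).resolve_left hi
  rw [← LinearMap.smul_apply, ← map_smul, smul_eq_smul_of_cross_eq_zero huv, map_smul,
    LinearMap.smul_apply, hvw, smul_zero]

theorem cross_eq_zero_of_dotProduct_eq_zero {a b u v : Fin 3 → A} (hab : a ⨯₃ b ≠ 0)
    (hau : a ⬝ᵥ u = 0) (hbu : b ⬝ᵥ u = 0) (hav : a ⬝ᵥ v = 0) (hbv : b ⬝ᵥ v = 0) :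
    u ⨯₃ v = 0 := by
  have key : ∀ w, a ⬝ᵥ w = 0 → b ⬝ᵥ w = 0 → (a ⨯₃ b) ⨯₃ w = 0 := fun w ha hb => by
    rw [cross_cross_eq_smul_sub_smul, ha, hb, zero_smul, zero_smul, sub_zero]
  exact cross_eq_zero_trans hab (cross_eq_zero_comm.1 (key u hau hbu)) (key v hav hbv)

end CrossProduct

section Field

variable {K : Type*} [Field K]

theorem exists_eq_smul_of_cross_eq_zero {u v : Fin 3 → K} (hv : v ≠ 0) (h : u ⨯₃ v = 0) :
    ∃ c : K, u = c • v := by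
  obtain ⟨i, hi⟩ := Function.ne_iff.1 hv
  refine ⟨u i / v i, ?_⟩
  rw [div_eq_inv_mul, mul_smul, ← smul_eq_smul_of_cross_eq_zero h, inv_smul_smul₀ hi]

end Field

section Derivations

variable {σ k R : Type*} [CommRing k] [CommRing R] [Algebra k R]

/-- The derivation of a polynomial ring obtained by applying `δ` to the coefficients. -/
noncomputable def coeffDerivation (δ : Derivation k R R) :
    Derivation k (MvPolynomial σ R) (MvPolynomial σ R) :=
  Derivation.mk'
    { toFun := fun H => .ofCoeff (Finsupp.mapRange δ (map_zero δ) (AddMonoidAlgebra.coeff H))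
      map_add' := fun G H => MvPolynomial.ext _ _ fun m => map_add δ (coeff m G) (coeff m H)
      map_smul' := fun c H => MvPolynomial.ext _ _ fun m => δ.map_smul c (coeff m H) }
    fun G H => by
      classical
      ext m
      change δ (coeff m (G * H)) = coeff m (G * _ + H * _)
      rw [mul_comm H]
      simp only [coeff_add, coeff_mul, map_sum, Derivation.leibniz, smul_eq_mul,
        Finset.sum_add_distrib, mul_comm (coeff _ H)]
      rfl

theorem coeff_coeffDerivation (δ : Derivation k R R) (m : σ →₀ ℕ) (H : MvPolynomial σ R) :
    coeff m (coeffDerivation δ H) = δ (coeff m H) := rfl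

theorem coeffDerivation_C (δ : Derivation k R R) (r : R) :
    coeffDerivation δ (C r : MvPolynomial σ R) = C (δ r) := by
  classical
  ext m
  simp only [coeff_coeffDerivation, coeff_C, apply_ite δ, map_zero]

theorem coeffDerivation_map_algebraMap (δ : Derivation k R R) (H : MvPolynomial σ k) :
    coeffDerivation δ (map (algebraMap k R) H) = 0 := by
  ext m
  simp [coeff_coeffDerivation, coeff_map]

theorem coeffDerivation_X (δ : Derivation k R R) (i : σ) :
    coeffDerivation δ (X i : MvPolynomial σ R) = 0 := by
  simpa using coeffDerivation_map_algebraMap δ (X i : MvPolynomial σ k)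

theorem coeffDerivation_zero (H : MvPolynomial σ R) :
    coeffDerivation (0 : Derivation k R R) H = 0 := by
  ext
  simp [coeff_coeffDerivation]

theorem isHomogeneous_coeffDerivation {δ : Derivation k R R} {H : MvPolynomial σ R} {n : ℕ}
    (hH : H.IsHomogeneous n) : (coeffDerivation δ H).IsHomogeneous n := by
  intro m hm
  refine hH fun h => hm ?_
  rw [coeff_coeffDerivation, h, map_zero]

/-- The value at `b` of the gradient of `H`. -/
noncomputable def gradAt {A : Type*} [CommRing A] [Algebra R A] (H : MvPolynomial σ R)
    (b : σ → A) : σ → A :=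
  fun i => aeval b (pderiv i H)

variable {A : Type*} [CommRing A] [Algebra k A] [Algebra R A] [Fintype σ]

theorem derivation_aeval {D : Derivation k A A} {δ : Derivation k R R}
    (hD : ∀ r, D (algebraMap R A r) = algebraMap R A (δ r)) (b : σ → A) (H : MvPolynomial σ R) :
    D (aeval b H) = aeval b (coeffDerivation δ H) + gradAt H b ⬝ᵥ (D ∘ b) := by
  classical
  simp only [dotProduct, gradAt, Function.comp_apply]
  induction H using MvPolynomial.induction_on with
  | C a => simp [coeffDerivation_C, hD]
  | add p q hp hq =>
    simp only [map_add, hp, hq, add_mul, Finset.sum_add_distrib]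
    abel
  | mul_X p j hp =>
    simp only [map_mul, aeval_X, Derivation.leibniz, smul_eq_mul, hp, map_add, pderiv_X, add_mul,
      Finset.sum_add_distrib, Finset.mul_sum, coeffDerivation_X, mul_zero, zero_add, mul_add]
    simp only [Pi.single_apply, apply_ite (aeval b), map_one, map_zero, mul_ite, mul_one, mul_zero,
      ite_mul, zero_mul, Finset.sum_ite_eq, Finset.mem_univ, if_true, mul_assoc]
    ring

theorem derivation_aeval_of_linear (D : Derivation R A A) (b : σ → A) (H : MvPolynomial σ R) :
    D (aeval b H) = gradAt H b ⬝ᵥ (D ∘ b) := by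
  rw [derivation_aeval (δ := 0) (by simp), coeffDerivation_zero, map_zero, zero_add]

end Derivations

theorem aeval_smul_of_isHomogeneous {σ R A : Type*} [CommRing R] [CommRing A] [Algebra R A]
    {H : MvPolynomial σ R} {n : ℕ} (hH : H.IsHomogeneous n) (c : A) (b : σ → A) :
    aeval (c • b) H = c ^ n * aeval b H := by
  rw [aeval_def, aeval_def, eval₂_eq, eval₂_eq, Finset.mul_sum]
  refine Finset.sum_congr rfl fun m hm => ?_
  simp only [Pi.smul_apply, smul_eq_mul, mul_pow, Finset.prod_mul_distrib,
    Finset.prod_pow_eq_pow_sum]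
  rw [← hH.degree_eq_sum_deg_support hm]
  ring

section CoordRing

variable {σ ι R : Type*} [CommRing R]

/-- The ring of regular functions on the affine hypersurface `F = 0`. -/
abbrev CoordRing (F : MvPolynomial σ R) : Type _ :=
  MvPolynomial σ R ⧸ Ideal.span {F}

/-- The restriction of polynomials to the hypersurface `F = 0`. -/
noncomputable abbrev restrict (F : MvPolynomial σ R) : MvPolynomial σ R →ₐ[R] CoordRing F :=
  Ideal.Quotient.mkₐ R (Ideal.span {F})

variable {F : MvPolynomial σ R}

theorem restrict_eq_zero_iff {G : MvPolynomial σ R} : restrict F G = 0 ↔ F ∣ G :=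
  Ideal.Quotient.eq_zero_iff_dvd F G

theorem restrict_surjective : Function.Surjective (restrict F) :=
  Ideal.Quotient.mkₐ_surjective R _

theorem restrict_aeval (b : ι → MvPolynomial σ R) (H : MvPolynomial ι R) :
    restrict F (aeval b H) = aeval (restrict F ∘ b) H := by
  rw [← AlgHom.comp_apply, comp_aeval]
  rfl

theorem restrict_self : restrict F F = 0 := restrict_eq_zero_iff.2 dvd_rfl

theorem aeval_restrict_X (G : MvPolynomial σ R) : aeval (restrict F ∘ X) G = restrict F G := by
  rw [← restrict_aeval, aeval_X_left_apply]

theorem isDomain_coordRing (hF : Prime F) : IsDomain (CoordRing F) := by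
  have := (Ideal.span_singleton_prime hF.ne_zero).2 hF
  infer_instance

theorem exists_derivation_restrict {k : Type*} [CommRing k] [Algebra k R]
    (D : Derivation k (MvPolynomial σ R) (MvPolynomial σ R)) (hD : F ∣ D F) :
    ∃ D' : Derivation k (CoordRing F) (CoordRing F), ∀ G, D' (restrict F G) = restrict F (D G) := by
  have hker : ∀ G, (restrict F).restrictScalars k G = 0 →
      (restrict F).restrictScalars k (D G) = 0 := by
    intro G hG
    obtain ⟨K, rfl⟩ := restrict_eq_zero_iff.1 hG
    refine restrict_eq_zero_iff.2 ?_
    rw [Derivation.leibniz]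
    exact dvd_add (dvd_mul_right F _) (hD.mul_left K)
  exact ⟨Derivation.liftOfSurjective (f := (restrict F).restrictScalars k) restrict_surjective hker,
    Derivation.liftOfSurjective_apply _ hker⟩

variable [IsDomain R] {d : ℕ}

theorem faithfulSMul_coordRing (hd : d ≠ 0) (hF : F.IsHomogeneous d) (hF0 : F ≠ 0) :
    FaithfulSMul R (CoordRing F) := by
  refine (faithfulSMul_iff_algebraMap_injective R _).2
    ((injective_iff_map_eq_zero (algebraMap R (CoordRing F))).2 fun r hr => ?_)
  have hdvd : F ∣ C r := restrict_eq_zero_iff.1 hr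
  by_contra hr0
  have := totalDegree_le_of_dvd_of_isDomain hdvd (by simpa using hr0)
  rw [hF.totalDegree hF0, totalDegree_C] at this
  exact hd (Nat.le_zero.1 this)

theorem not_algebraicIndependent_coordRing [Finite σ] (hF : Prime F)
    [FaithfulSMul R (CoordRing F)] (b : σ → CoordRing F) : ¬ AlgebraicIndependent R b := by
  intro hb
  have := isDomain_coordRing hF
  have hadj : Algebra.adjoin R (Set.range (restrict F ∘ X)) = ⊤ := by
    rw [Set.range_comp, Algebra.adjoin_image, adjoin_range_X, Algebra.map_top]
    exact (AlgHom.range_eq_top _).2 restrict_surjective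
  have : Algebra.IsAlgebraic (Algebra.adjoin R (Set.range (restrict F ∘ X))) (CoordRing F) :=
    ⟨fun a => isAlgebraic_algebraMap
      (⟨a, hadj ▸ Algebra.mem_top⟩ : Algebra.adjoin R (Set.range (restrict F ∘ X)))⟩
  have hX := Algebra.IsAlgebraic.isTranscendenceBasis_of_lift_le_trdeg_of_finite R (restrict F ∘ X)
    hb.lift_cardinalMk_le_trdeg
  refine hF.ne_zero (algebraicIndependent_iff.1 hX.1 F ?_)
  rw [aeval_restrict_X, restrict_self]

end CoordRing

section MinimalRelation

variable {σ R A : Type*} [CommRing R] [CommRing A] [Algebra R A]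

/-- `H` is a form of degree `n` vanishing at `b`, minimal in the sense that its gradient does not
vanish at `b`, nor does any nonzero partial derivative. In characteristic zero, a nonzero form of
least degree among those vanishing at `b` has this property. -/
structure IsMinimalRelation (b : σ → A) (n : ℕ) (H : MvPolynomial σ R) : Prop where
  isHomogeneous : H.IsHomogeneous n
  aeval_eq_zero : aeval b H = 0
  pderiv_eq_zero : ∀ i, gradAt H b i = 0 → pderiv i H = 0
  gradAt_ne_zero : gradAt H b ≠ 0

theorem gradAt_dotProduct_self [Fintype σ] {H : MvPolynomial σ R} {n : ℕ} (hH : H.IsHomogeneous n)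
    (b : σ → A) : gradAt H b ⬝ᵥ b = n • aeval b H := by
  rw [← map_nsmul, ← hH.sum_X_mul_pderiv, map_sum]
  exact Finset.sum_congr rfl fun i _ => by rw [map_mul, aeval_X, gradAt, mul_comm]

theorem IsMinimalRelation.dotProduct_self [Fintype σ] {b : σ → A} {H : MvPolynomial σ R} {n : ℕ}
    (hH : IsMinimalRelation b n H) : gradAt H b ⬝ᵥ b = 0 := by
  rw [gradAt_dotProduct_self hH.isHomogeneous, hH.aeval_eq_zero, smul_zero]

theorem IsMinimalRelation.dotProduct_derivation [Fintype σ] {b : σ → A} {H : MvPolynomial σ R}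
    {n : ℕ} (hH : IsMinimalRelation b n H) (D : Derivation R A A) :
    gradAt H b ⬝ᵥ (D ∘ b) = 0 := by
  rw [← derivation_aeval_of_linear, hH.aeval_eq_zero, map_zero]

theorem exists_isMinimalRelation [Finite σ] [IsDomain R] [CharZero R] [FaithfulSMul R A] {b : σ → A}
    (hb : ¬ AlgebraicIndependent R b)
    (hcomp : ∀ (H : MvPolynomial σ R) n, aeval b H = 0 → aeval b (homogeneousComponent n H) = 0) :
    ∃ n H, IsMinimalRelation (R := R) b n H := by
  classical
  have hex : ∃ n, ∃ H : MvPolynomial σ R, H.IsHomogeneous n ∧ H ≠ 0 ∧ aeval b H = 0 := by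
    obtain ⟨H, hH, hH0⟩ : ∃ H : MvPolynomial σ R, aeval b H = 0 ∧ H ≠ 0 := by
      simpa [algebraicIndependent_iff] using hb
    obtain ⟨n, hn⟩ : ∃ n, homogeneousComponent n H ≠ 0 := by
      by_contra! hc
      exact hH0 (by rw [← sum_homogeneousComponent H, Finset.sum_eq_zero fun n _ => hc n])
    exact ⟨n, _, homogeneousComponent_isHomogeneous n H, hn, hcomp H n hH⟩
  obtain ⟨H, hHn, hH0, hH⟩ := Nat.find_spec hex
  set n := Nat.find hex
  have hn : n ≠ 0 := by
    intro hn
    rw [hn, ← totalDegree_zero_iff_isHomogeneous, totalDegree_eq_zero_iff_eq_C] at hHn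
    rw [hHn, aeval_C, FaithfulSMul.algebraMap_eq_zero_iff] at hH
    exact hH0 (by rw [hHn, hH, C_0])
  have hmin : ∀ i, gradAt H b i = 0 → pderiv i H = 0 := fun i hi => by
    by_contra hne
    exact Nat.find_min hex (m := n - 1) (by omega) ⟨_, hHn.pderiv, hne, hi⟩
  refine ⟨n, H, hHn, hH, hmin, fun hgrad => ?_⟩
  have := Fintype.ofFinite σ
  have heuler := hHn.sum_X_mul_pderiv
  rw [Finset.sum_eq_zero fun i _ => by rw [hmin i (congrFun hgrad i), mul_zero], eq_comm,
    smul_eq_zero] at heuler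
  exact heuler.elim hn hH0

theorem homogeneousComponent_aeval {τ : Type*} {e : ℕ} (he : e ≠ 0) {f : σ → MvPolynomial τ R}
    (hf : ∀ i, (f i).IsHomogeneous e) (H : MvPolynomial σ R) (n : ℕ) :
    homogeneousComponent (e * n) (aeval f H) = aeval f (homogeneousComponent n H) := by
  have h (m : ℕ) : (aeval f (homogeneousComponent m H)).IsHomogeneous (e * m) :=
    (homogeneousComponent_isHomogeneous m H).aeval f hf
  conv_lhs => rw [← sum_homogeneousComponent H, map_sum, map_sum]
  simp only [homogeneousComponent_of_mem (h _), mul_right_inj' he, Finset.sum_ite_eq,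
    Finset.mem_range]
  split_ifs with hn
  · rfl
  · rw [homogeneousComponent_eq_zero _ _ (by omega), map_zero]

theorem dvd_homogeneousComponent {F G : MvPolynomial σ R} {d : ℕ} (hF : F.IsHomogeneous d)
    (hG : F ∣ G) (n : ℕ) : F ∣ homogeneousComponent n G := by
  let _ : GradedAlgebra (homogeneousSubmodule σ R) := gradedAlgebra
  have hspan : (Ideal.span {F}).IsHomogeneous (homogeneousSubmodule σ R) :=
    Ideal.homogeneous_span _ _ fun K hK => ⟨d, (Set.mem_singleton_iff.1 hK) ▸ hF⟩
  exact Ideal.mem_span_singleton.1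
    (homogeneousComponent_mem_of_mem hspan (Ideal.mem_span_singleton.2 hG) n)

theorem exists_isMinimalRelation_restrict [Finite σ] [IsDomain R] [CharZero R]
    {F : MvPolynomial σ R} {d e : ℕ} (hd : d ≠ 0) (hF : F.IsHomogeneous d) (hFp : Prime F)
    (he : e ≠ 0) {f : σ → MvPolynomial σ R} (hf : ∀ i, (f i).IsHomogeneous e) :
    ∃ n H, IsMinimalRelation (R := R) (restrict F ∘ f) n H := by
  have := faithfulSMul_coordRing hd hF hFp.ne_zero
  refine exists_isMinimalRelation (not_algebraicIndependent_coordRing hFp _) fun H n hH => ?_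
  rw [← restrict_aeval, restrict_eq_zero_iff] at hH ⊢
  rw [← homogeneousComponent_aeval he hf]
  exact dvd_homogeneousComponent hF hH _

end MinimalRelation

section RationalDetermination

variable {R A : Type*} [CommRing R] [CommRing A] [Algebra R A]

theorem pow_mul_aeval_of_cross_eq_zero {u v : Fin 3 → A} (h : u ⨯₃ v = 0) {n : ℕ}
    {G : MvPolynomial (Fin 3) R} (hG : G.IsHomogeneous n) (i : Fin 3) :
    v i ^ n * aeval u G = u i ^ n * aeval v G := by
  rw [← aeval_smul_of_isHomogeneous hG, smul_eq_smul_of_cross_eq_zero h,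
    aeval_smul_of_isHomogeneous hG]

/-- The point `v` of the projective plane is a rational function of `u`: some triple of forms
`g` of the same degree satisfies `[g u] = [v]`. -/
def RationallyDetermines (R : Type*) {A : Type*} [CommRing R] [CommRing A] [Algebra R A]
    (u v : Fin 3 → A) : Prop :=
  ∃ (e : ℕ) (g : Fin 3 → MvPolynomial (Fin 3) R), (∀ i, (g i).IsHomogeneous e) ∧
    aeval u ∘ g ≠ 0 ∧ (aeval u ∘ g) ⨯₃ v = 0

variable [IsDomain A]

theorem RationallyDetermines.trans {u v w : Fin 3 → A} (huv : RationallyDetermines R u v)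
    (hvw : RationallyDetermines R v w) : RationallyDetermines R u w := by
  obtain ⟨e, g, hg, hgu, hguv⟩ := huv
  obtain ⟨e', h, hh, hhv, hhvw⟩ := hvw
  obtain ⟨i, hi⟩ := Function.ne_iff.1 hgu
  have hcomp : aeval u ∘ (aeval g ∘ h) = aeval (aeval u ∘ g) ∘ h :=
    funext fun l => comp_aeval_apply g (aeval u) (h l)
  have key : v i ^ e' • (aeval (aeval u ∘ g) ∘ h) = (aeval u ∘ g) i ^ e' • (aeval v ∘ h) :=
    funext fun l => pow_mul_aeval_of_cross_eq_zero hguv (hh l) i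
  have hne : v i ^ e' • (aeval (aeval u ∘ g) ∘ h) ≠ 0 :=
    key ▸ smul_ne_zero (pow_ne_zero _ hi) hhv
  refine ⟨e * e', aeval g ∘ h, fun l => (hh l).aeval g hg, ?_, ?_⟩
  · exact hcomp ▸ right_ne_zero_of_smul hne
  · have hcross : v i ^ e' • ((aeval (aeval u ∘ g) ∘ h) ⨯₃ w) = 0 := by
      rw [← LinearMap.smul_apply, ← map_smul, key, map_smul, LinearMap.smul_apply, hhvw, smul_zero]
    exact hcomp ▸ (smul_eq_zero.1 hcross).resolve_left (left_ne_zero_of_smul hne)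

theorem RationallyDetermines.of_smul {a : A} {u v : Fin 3 → A}
    (h : RationallyDetermines R (a • u) v) : RationallyDetermines R u v := by
  obtain ⟨e, g, hg, hgu, hguv⟩ := h
  have hsmul : aeval (a • u) ∘ g = a ^ e • (aeval u ∘ g) :=
    funext fun i => aeval_smul_of_isHomogeneous (hg i) a u
  rw [hsmul] at hgu hguv
  rw [map_smul, LinearMap.smul_apply] at hguv
  exact ⟨e, g, hg, right_ne_zero_of_smul hgu,
    (smul_eq_zero.1 hguv).resolve_left (left_ne_zero_of_smul hgu)⟩

/-- The tangent line to the curve traced by `v` is given by the gradient of an equation of that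
curve, so it determines any line through `v` that is stationary along `D`. -/
theorem IsMinimalRelation.rationallyDetermines {n : ℕ} {H : MvPolynomial (Fin 3) R}
    {u v : Fin 3 → A} (hH : IsMinimalRelation v n H) {D : Derivation R A A}
    (hv : v ⨯₃ (D ∘ v) ≠ 0) (huv : v ⬝ᵥ u = 0) (huDv : (D ∘ v) ⬝ᵥ u = 0) :
    RationallyDetermines R v u :=
  ⟨n - 1, fun i => pderiv i H, fun _ => hH.isHomogeneous.pderiv, hH.gradAt_ne_zero,
    cross_eq_zero_of_dotProduct_eq_zero hv (dotProduct_comm v _ ▸ hH.dotProduct_self)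
      (dotProduct_comm (D ∘ v) _ ▸ hH.dotProduct_derivation D) huv huDv⟩

end RationalDetermination

section Constants

theorem aeval_add_smul_of_polar_eq_zero {σ R A : Type*} [Fintype σ] [CommRing R] [CommRing A]
    [IsDomain A] [CharZero A] [Algebra R A] {H : MvPolynomial σ R} {v : σ → R}
    (h : (fun i => pderiv i H) ⬝ᵥ (C ∘ v) = 0) (a : σ → A) (t : A) :
    aeval (a + t • (algebraMap R A ∘ v)) H = aeval a H := by
  let b : σ → Polynomial A := fun i =>
    Polynomial.C (a i) + Polynomial.C (algebraMap R A (v i)) * Polynomial.X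
  have hderiv : Polynomial.derivative (aeval b H) = 0 := by
    have hb (i : σ) : Polynomial.derivative (b i) = aeval b (C (v i)) := by
      simp [b, Polynomial.algebraMap_apply]
    let D : Derivation R (Polynomial A) (Polynomial A) :=
      (Polynomial.derivative' (R := A)).restrictScalars R
    refine (derivation_aeval_of_linear D b H).trans ?_
    rw [← map_zero (aeval (R := R) b), ← h, dotProduct, dotProduct, map_sum]
    exact Finset.sum_congr rfl fun i _ => by rw [map_mul]; exact congrArg _ (hb i)
  have heval (c : A) : Polynomial.eval c (aeval b H) = aeval (a + c • (algebraMap R A ∘ v)) H := by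
    rw [← Polynomial.coe_aeval_eq_eval,
      ← AlgHom.restrictScalars_apply R (Polynomial.aeval c : Polynomial A →ₐ[A] A),
      comp_aeval_apply]
    congr 2
    ext i
    simp [b, mul_comm c]
  rw [← heval, Polynomial.eq_C_of_derivative_eq_zero hderiv, Polynomial.eval_C,
    Polynomial.coeff_zero_eq_eval_zero, heval, zero_smul, add_zero]

variable {k : Type*} [Field k] [CharZero k]

theorem aeval_eq_pow_mul_of_pderiv_two_eq_zero {K : Type*} [Field K] [Algebra k K]
    {H : MvPolynomial (Fin 3) k} {n : ℕ} (hH : H.IsHomogeneous n) (h2 : pderiv 2 H = 0)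
    {x y : K} (hy : y ≠ 0) (z : K) :
    aeval ![x, y, z] H =
      y ^ n * Polynomial.aeval (x / y) (aeval ![Polynomial.X, 1, 0] H : Polynomial k) := by
  have := charZero_of_injective_algebraMap (algebraMap k K).injective
  have hz := aeval_add_smul_of_polar_eq_zero (v := ![0, 0, 1]) (H := H)
    (by simp [Fin.sum_univ_three, dotProduct, h2]) ![x, y, 0] z
  rw [comp_aeval_apply, ← aeval_smul_of_isHomogeneous hH]
  convert hz using 2
  · ext i
    fin_cases i <;> simp [Matrix.vecHead, Matrix.vecTail]
  · ext i
    fin_cases i <;> simp [mul_div_cancel₀, hy]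

theorem exists_algebraMap_eq_div_of_binary_form [IsAlgClosed k] {K : Type*} [Field K] [Algebra k K]
    {H : MvPolynomial (Fin 3) k} {n : ℕ} (hH : H.IsHomogeneous n) (hH0 : H ≠ 0)
    (h2 : pderiv 2 H = 0) {x y z : K} (hy : y ≠ 0) (h : aeval ![x, y, z] H = 0) :
    ∃ c : k, algebraMap k K c = x / y := by
  set p : Polynomial k := aeval ![Polynomial.X, 1, 0] H with hp
  have hp0 : p ≠ 0 := by
    intro hp0
    let ι := IsScalarTower.toAlgHom k (MvPolynomial (Fin 3) k)
      (FractionRing (MvPolynomial (Fin 3) k))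
    have hι : Function.Injective ι := IsFractionRing.injective _ _
    have := aeval_eq_pow_mul_of_pderiv_two_eq_zero hH h2
      ((map_ne_zero_iff ι hι).2 (X_ne_zero 1)) (x := ι (X 0)) (ι (X 2))
    rw [← hp, hp0, map_zero, mul_zero] at this
    refine hH0 ((map_eq_zero_iff ι hι).1 ?_)
    conv_lhs => rw [← aeval_X_left_apply H, comp_aeval_apply]
    rw [← this]
    congr 2
    ext i
    fin_cases i <;> rfl
  have hroot : Polynomial.aeval (x / y) p = 0 := by
    rw [aeval_eq_pow_mul_of_pderiv_two_eq_zero hH h2 hy] at h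
    exact (mul_eq_zero.1 h).resolve_left (pow_ne_zero n hy)
  have hint : IsIntegral k (x / y) := IsAlgebraic.isIntegral ⟨p, hp0, hroot⟩
  exact minpoly.mem_range_of_degree_eq_one k _
    (IsAlgClosed.degree_eq_one_of_irreducible k (minpoly.irreducible hint))

theorem exists_eq_algebraMap_mul_of_wronskian_eq_zero [IsAlgClosed k] {A : Type*} [CommRing A]
    [IsDomain A] [Algebra k A] {D : Derivation k A A} {p q x z : A} (hz : z ≠ 0)
    (hDz : D z = 0) (hDx : D x ≠ 0) (hq : q ≠ 0) (hpq : q * D p = p * D q) {n : ℕ}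
    {H : MvPolynomial (Fin 3) k}
    (hH : IsMinimalRelation ![p * z, q * z, q * x] n H) : ∃ c : k, p = algebraMap k A c * q := by
  set b : Fin 3 → A := ![p * z, q * z, q * x] with hb
  -- The tangent to the curve `[p z : q z : q x]` is orthogonal to both `b` and `D b`; as `p / q`
  -- is stationary, it is the line joining `b` to `[0 : 0 : 1]`, and `H` is a binary form.
  have h2 : pderiv 2 H = 0 := by
    refine hH.pderiv_eq_zero 2 ?_
    have hself := hH.dotProduct_self
    have hder := hH.dotProduct_derivation D
    simp only [hb, dotProduct, Fin.sum_univ_three, Function.comp_apply, Matrix.cons_val,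
      Derivation.leibniz, smul_eq_mul, hDz] at hself hder
    have : gradAt H b 2 * (q * q * D x) = 0 := by
      linear_combination q * hder - D q * hself - gradAt H b 0 * z * hpq
    exact (mul_eq_zero.1 this).resolve_right (mul_ne_zero (mul_ne_zero hq hq) hDx)
  let ι := IsScalarTower.toAlgHom k A (FractionRing A)
  have hι : Function.Injective ι := IsFractionRing.injective _ _
  have hιz : ι z ≠ 0 := (map_ne_zero_iff ι hι).2 hz
  have hιq : ι q ≠ 0 := (map_ne_zero_iff ι hι).2 hq
  have hH0 : H ≠ 0 := fun h => hH.gradAt_ne_zero <| by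
    ext i
    simp [gradAt, h]
  have hιH : aeval ![ι (p * z), ι (q * z), ι (q * x)] H = 0 := by
    rw [← map_zero ι, ← hH.aeval_eq_zero, comp_aeval_apply]
    congr 2
    ext i
    fin_cases i <;> rfl
  obtain ⟨c, hc⟩ := exists_algebraMap_eq_div_of_binary_form hH.isHomogeneous hH0 h2
    ((map_ne_zero_iff ι hι).2 (mul_ne_zero hq hz)) hιH
  refine ⟨c, hι ?_⟩
  rw [map_mul, map_mul, mul_div_mul_right _ _ hιz, eq_div_iff hιq] at hc
  rw [map_mul, ι.commutes, ← hc]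

end Constants

section Envelope

variable {k : Type*} [Field k]

theorem eq_zero_of_dotProduct_algebraMap_eq_zero {A : Type*} [CommRing A] [Algebra k A]
    {u : Fin 3 → A} (hu : LinearIndependent k u) {c : Fin 3 → k}
    (hc : u ⬝ᵥ (algebraMap k A ∘ c) = 0) : c = 0 := by
  refine funext (Fintype.linearIndependent_iff.1 hu c ?_)
  rw [← hc]
  exact Finset.sum_congr rfl fun i _ => by rw [Algebra.smul_def, mul_comm, Function.comp_apply]

variable [CharZero k] [IsAlgClosed k] {F : MvPolynomial (Fin 3) k} {d : ℕ}
  {D : Derivation k (CoordRing F) (CoordRing F)}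

theorem exists_cross_algebraMap_eq_zero (hd : d ≠ 0) (hF : F.IsHomogeneous d) (hFp : Prime F)
    (hX : restrict F (X 2) ≠ 0) (hD2 : D (restrict F (X 2)) = 0) (hD0 : D (restrict F (X 0)) ≠ 0)
    {e : ℕ} {f : Fin 3 → MvPolynomial (Fin 3) k} (hf : ∀ i, (f i).IsHomogeneous e)
    (hf0 : restrict F ∘ f ≠ 0) (h : (restrict F ∘ f) ⨯₃ (D ∘ restrict F ∘ f) = 0) :
    ∃ c : Fin 3 → k, c ≠ 0 ∧ (restrict F ∘ f) ⨯₃ (algebraMap k (CoordRing F) ∘ c) = 0 := by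
  have := isDomain_coordRing hFp
  obtain ⟨l, hl⟩ := Function.ne_iff.1 hf0
  have hconst (i : Fin 3) : ∃ c : k, restrict F (f i) = algebraMap k _ c * restrict F (f l) := by
    have hb (j : Fin 3) :
        ((![f i * X 2, f l * X 2, f l * X 0] : Fin 3 → _) j).IsHomogeneous (e + 1) := by
      fin_cases j
      · exact (hf i).mul (isHomogeneous_X k 2)
      · exact (hf l).mul (isHomogeneous_X k 2)
      · exact (hf l).mul (isHomogeneous_X k 0)
    obtain ⟨n, H, hH⟩ := exists_isMinimalRelation_restrict hd hF hFp e.succ_ne_zero hb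
    refine exists_eq_algebraMap_mul_of_wronskian_eq_zero (n := n) (H := H) hX hD2 hD0 hl ?_ ?_
    · have := congrFun (smul_eq_smul_of_cross_eq_zero h l) i
      exact this.symm.trans (mul_comm _ _)
    · convert hH
      ext j
      fin_cases j <;> simp
  choose c hc using hconst
  have hfc : restrict F ∘ f = restrict F (f l) • (algebraMap k (CoordRing F) ∘ c) :=
    funext fun i => (hc i).trans (mul_comm _ _)
  refine ⟨c, ?_, by rw [hfc, map_smul, LinearMap.smul_apply, cross_self, smul_zero]⟩
  rintro rfl
  refine hf0 (hfc.trans ?_)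
  ext i
  simp

theorem cross_derivation_ne_zero (hd : d ≠ 0) (hF : F.IsHomogeneous d) (hFp : Prime F)
    (hX : restrict F (X 2) ≠ 0) (hD2 : D (restrict F (X 2)) = 0) (hD0 : D (restrict F (X 0)) ≠ 0)
    {e : ℕ} {f : Fin 3 → MvPolynomial (Fin 3) k} (hf : ∀ i, (f i).IsHomogeneous e)
    (hlin : LinearIndependent k (restrict F ∘ f)) :
    (restrict F ∘ f) ⨯₃ (D ∘ restrict F ∘ f) ≠ 0 := by
  have := isDomain_coordRing hFp
  have := faithfulSMul_coordRing hd hF hFp.ne_zero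
  intro h0
  obtain ⟨c, hc0, hc⟩ := exists_cross_algebraMap_eq_zero hd hF hFp hX hD2 hD0 hf
    (fun h => hlin.ne_zero 0 (congrFun h 0)) h0
  obtain ⟨b, hb0, hbc⟩ := exists_ne_zero_dotProduct_eq_zero c
  refine hb0 (eq_zero_of_dotProduct_algebraMap_eq_zero hlin ?_)
  refine dotProduct_eq_zero_of_cross_eq_zero (w := algebraMap k _ ∘ c) ?_
    (cross_eq_zero_comm.1 hc) ?_
  · obtain ⟨i, hi⟩ := Function.ne_iff.1 hc0
    exact Function.ne_iff.2 ⟨i, by simpa using hi⟩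
  · exact ((algebraMap k (CoordRing F)).map_dotProduct c b).symm.trans
      (by rw [dotProduct_comm, hbc, map_zero])

theorem rationallyDetermines_of_eq_cross_derivation (hd : d ≠ 0) (hF : F.IsHomogeneous d)
    (hFp : Prime F) (hX : restrict F (X 2) ≠ 0) (hD2 : D (restrict F (X 2)) = 0)
    (hD0 : D (restrict F (X 0)) ≠ 0) {e e' : ℕ} {f g : Fin 3 → MvPolynomial (Fin 3) k}
    (hf : ∀ i, (f i).IsHomogeneous e) (he' : e' ≠ 0) (hg : ∀ i, (g i).IsHomogeneous e')
    (hlin : LinearIndependent k (restrict F ∘ f))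
    (hfg : restrict F ∘ g = (restrict F ∘ f) ⨯₃ (D ∘ restrict F ∘ f)) :
    RationallyDetermines k (restrict F ∘ g) (restrict F ∘ f) := by
  have := isDomain_coordRing hFp
  set u := restrict F ∘ f
  set v := restrict F ∘ g
  have hv0 : v ≠ 0 := hfg ▸ cross_derivation_ne_zero hd hF hFp hX hD2 hD0 hf hlin
  have hvu : v ⬝ᵥ u = 0 := by rw [hfg, dotProduct_comm, dot_self_cross]
  have hvDu : v ⬝ᵥ (D ∘ u) = 0 := by rw [hfg, dotProduct_comm, dot_cross_self]
  have hDvu : (D ∘ v) ⬝ᵥ u = 0 := by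
    have := derivation_dotProduct D v u
    rwa [hvu, map_zero, hvDu, add_zero, eq_comm] at this
  obtain ⟨n, H, hH⟩ := exists_isMinimalRelation_restrict hd hF hFp he' hg
  refine hH.rationallyDetermines (D := D) (fun h0 => ?_) hvu hDvu
  obtain ⟨c, hc0, hc⟩ := exists_cross_algebraMap_eq_zero hd hF hFp hX hD2 hD0 hg hv0 h0
  refine hc0 (eq_zero_of_dotProduct_algebraMap_eq_zero hlin ?_)
  rw [dotProduct_comm]
  exact dotProduct_eq_zero_of_cross_eq_zero hv0 hc hvu

end Envelope

section Curve

theorem dvd_of_forall_eval_eq_zero {σ k : Type*} [Finite σ] [Field k] [IsAlgClosed k]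
    {F G : MvPolynomial σ k} (hF : Prime F) (h : ∀ z : σ → k, eval z F = 0 → eval z G = 0) :
    F ∣ G := by
  have hP : (Ideal.span {F}).IsPrime := (Ideal.span_singleton_prime hF.ne_zero).2 hF
  have hV := IsPrime.vanishingIdeal_zeroLocus (K := k) (Ideal.span {F})
  rw [← Ideal.mem_span_singleton, ← hV, mem_vanishingIdeal_iff]
  intro z hz
  have := h z
  simp only [← coe_aeval_eq_eval, RingHom.coe_coe] at this
  exact this (hz F (Ideal.mem_span_singleton_self F))

theorem exists_eval_eq_zero_of_not_dvd {σ k : Type*} [Finite σ] [Field k] [IsAlgClosed k]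
    {F G : MvPolynomial σ k} (hF : Prime F) (h : ¬ F ∣ G) :
    ∃ z : σ → k, eval z F = 0 ∧ eval z G ≠ 0 := by
  by_contra! hc
  exact h (dvd_of_forall_eval_eq_zero hF hc)

theorem not_dvd_of_isHomogeneous_of_lt {σ R : Type*} [CommRing R] [IsDomain R]
    {F G : MvPolynomial σ R} {d n : ℕ} (hF : F.IsHomogeneous d) (hF0 : F ≠ 0)
    (hG : G.IsHomogeneous n) (hG0 : G ≠ 0) (hn : n < d) : ¬ F ∣ G := by
  intro h
  have := totalDegree_le_of_dvd_of_isDomain h hG0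
  rw [hF.totalDegree hF0, hG.totalDegree hG0] at this
  omega

theorem not_dvd_X {σ R : Type*} [CommRing R] [IsDomain R] {F : MvPolynomial σ R} {d : ℕ}
    (hd : 2 ≤ d) (hF : F.IsHomogeneous d) (hF0 : F ≠ 0) (i : σ) : ¬ F ∣ X i :=
  not_dvd_of_isHomogeneous_of_lt hF hF0 (isHomogeneous_X R i) (X_ne_zero i) (by omega)

variable {σ k : Type*} [Fintype σ] [Field k]

/-- The linear form with coefficients `u`. -/
noncomputable def linForm (u : σ → k) : MvPolynomial σ k := X ⬝ᵥ (C ∘ u)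

theorem eval_linForm (u z : σ → k) : eval z (linForm u) = z ⬝ᵥ u := by
  simp [linForm, dotProduct]

theorem isHomogeneous_linForm (u : σ → k) : (linForm u).IsHomogeneous 1 :=
  IsHomogeneous.sum _ _ _ fun i _ => (isHomogeneous_X k i).mul (isHomogeneous_C σ (u i))

theorem linForm_ne_zero {u : σ → k} (hu : u ≠ 0) : linForm u ≠ 0 := by
  classical
  obtain ⟨i, hi⟩ := Function.ne_iff.1 hu
  intro h
  have := eval_linForm u (Pi.single i 1)
  rw [h, map_zero, single_one_dotProduct] at this
  exact hi this.symm

theorem irreducible_linForm {u : σ → k} (hu : u ≠ 0) : Irreducible (linForm u) := by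
  have h0 := linForm_ne_zero hu
  refine irreducible_of_totalDegree_eq_one ((isHomogeneous_linForm u).totalDegree h0) ?_
  intro x hx
  refine isUnit_iff_ne_zero.2 ?_
  rintro rfl
  exact h0 (MvPolynomial.ext _ _ fun m => by simpa using hx m)

variable {F : MvPolynomial σ k} {d : ℕ}

theorem not_dvd_linForm (hd : 2 ≤ d) (hF : F.IsHomogeneous d) (hF0 : F ≠ 0) {u : σ → k}
    (hu : u ≠ 0) : ¬ F ∣ linForm u :=
  not_dvd_of_isHomogeneous_of_lt hF hF0 (isHomogeneous_linForm u) (linForm_ne_zero hu) (by omega)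

theorem exists_eq_smul_add_smul_of_cross_dotProduct_eq_zero {a v z : Fin 3 → k}
    (hav : a ⨯₃ v ≠ 0) (hz : z ⬝ᵥ (a ⨯₃ v) = 0) : ∃ c t : k, z = c • a + t • v := by
  have hv : v ≠ 0 := by
    rintro rfl
    exact hav (map_zero _)
  obtain ⟨c, hc⟩ : ∃ c : k, z ⨯₃ v = c • (a ⨯₃ v) := by
    refine exists_eq_smul_of_cross_eq_zero hav ?_
    rw [cross_cross_eq_smul_sub_smul, hz, dot_cross_self, zero_smul, zero_smul, sub_zero]
  obtain ⟨t, ht⟩ := exists_eq_smul_of_cross_eq_zero (u := z - c • a) hv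
    (by rw [map_sub, LinearMap.sub_apply, hc, map_smul, LinearMap.smul_apply, sub_self])
  exact ⟨c, t, by rw [← ht, add_sub_cancel]⟩

/-- A curve with a vanishing polar is a cone with vertex `v`, hence contains the line joining
`v` to any of its points. -/
theorem polar_ne_zero [IsAlgClosed k] [CharZero k] {F : MvPolynomial (Fin 3) k} (hd : 2 ≤ d)
    (hF : F.IsHomogeneous d) (hFp : Prime F) {v : Fin 3 → k} (hv : v ≠ 0) :
    (fun i => pderiv i F) ⬝ᵥ (C ∘ v) ≠ 0 := by
  intro hpol
  obtain ⟨h, hh0, hhv⟩ := exists_ne_zero_dotProduct_eq_zero v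
  obtain ⟨a, hFa, hha⟩ := exists_eval_eq_zero_of_not_dvd hFp
    (not_dvd_linForm hd hF hFp.ne_zero hh0)
  rw [eval_linForm] at hha
  have hl0 : a ⨯₃ v ≠ 0 := fun h0 => hha <|
    dotProduct_eq_zero_of_cross_eq_zero hv (cross_eq_zero_comm.1 h0) (by rw [dotProduct_comm, hhv])
  have hdvd : linForm (a ⨯₃ v) ∣ F := by
    refine dvd_of_forall_eval_eq_zero (irreducible_linForm hl0).prime fun z hz => ?_
    rw [eval_linForm] at hz
    obtain ⟨c, t, rfl⟩ := exists_eq_smul_add_smul_of_cross_dotProduct_eq_zero hl0 hz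
    refine (aeval_add_smul_of_polar_eq_zero hpol (c • a) t).trans ?_
    rw [aeval_smul_of_isHomogeneous hF, aeval_eq_eval, hFa, mul_zero]
  exact not_dvd_linForm hd hF hFp.ne_zero hl0
    ((irreducible_linForm hl0).dvd_symm hFp.irreducible hdvd)

theorem not_dvd_polar [IsAlgClosed k] [CharZero k] {F : MvPolynomial (Fin 3) k} (hd : 2 ≤ d)
    (hF : F.IsHomogeneous d) (hFp : Prime F) {v : Fin 3 → k} (hv : v ≠ 0) :
    ¬ F ∣ (fun i => pderiv i F) ⬝ᵥ (C ∘ v) :=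
  not_dvd_of_isHomogeneous_of_lt hF hFp.ne_zero
    (IsHomogeneous.sum _ _ _ fun i _ => hF.pderiv.mul (isHomogeneous_C _ _))
    (polar_ne_zero hd hF hFp hv) (by omega)

theorem not_dvd_pderiv [IsAlgClosed k] [CharZero k] {F : MvPolynomial (Fin 3) k} (hd : 2 ≤ d)
    (hF : F.IsHomogeneous d) (hFp : Prime F) (i : Fin 3) : ¬ F ∣ pderiv i F := by
  have := not_dvd_polar hd hF hFp (v := Pi.single i 1) (by simp)
  simpa [dotProduct, Pi.single_apply, apply_ite] using this

theorem not_dvd_sq_add_sq {F : Poly3} (hd : 2 ≤ d) (hF : F.IsHomogeneous d) (hFp : Prime F) :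
    ¬ F ∣ gradPoly F 0 ^ 2 + gradPoly F 1 ^ 2 := by
  have hI : (C Complex.I : Poly3) * C Complex.I = -1 := by rw [← C_mul, Complex.I_mul_I]; simp
  have hfactor : gradPoly F 0 ^ 2 + gradPoly F 1 ^ 2 =
      (gradPoly F ⬝ᵥ (C ∘ ![1, Complex.I, 0])) * (gradPoly F ⬝ᵥ (C ∘ ![1, -Complex.I, 0])) := by
    simp only [dotProduct, Fin.sum_univ_three, Function.comp_apply, Matrix.cons_val, map_one,
      map_zero, map_neg]
    linear_combination (gradPoly F 1 ^ 2) * hI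
  rw [hfactor, hFp.dvd_mul, not_or]
  exact ⟨not_dvd_polar hd hF hFp fun h => by simpa using congrFun h 0,
    not_dvd_polar hd hF hFp fun h => by simpa using congrFun h 0⟩

end Curve

section OrthSymm

variable {A : Type*} [CommRing A]

theorem orthSymm_apply (t v : Fin 3 → A) (i : Fin 3) :
    orthSymm t v i = (t 0 ^ 2 + t 1 ^ 2) * v i -
      2 * (t 0 * v 0 + t 1 * v 1 + t 2 * v 2) * (![t 0, t 1, 0] : Fin 3 → A) i := by
  simp only [orthSymm, dotProduct, Fin.sum_univ_three, Pi.sub_apply, Pi.smul_apply, smul_eq_mul]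

theorem orthSymm_orthSymm (t v : Fin 3 → A) :
    orthSymm t (orthSymm t v) = (t 0 ^ 2 + t 1 ^ 2) ^ 2 • v := by
  funext i
  fin_cases i <;> simp [orthSymm_apply] <;> ring

theorem orthSymm_of_dotProduct_eq_zero {t v : Fin 3 → A} (h : t ⬝ᵥ v = 0) :
    orthSymm t v = (t 0 ^ 2 + t 1 ^ 2) • v := by
  rw [orthSymm, h, mul_zero, zero_smul, sub_zero]

theorem isLinearMap_orthSymm (t : Fin 3 → A) : IsLinearMap A (orthSymm t) where
  map_add u v := by
    simp only [orthSymm, dotProduct_add, mul_add, add_smul, smul_add, add_sub_add_comm]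
  map_smul c v := by
    rw [orthSymm, orthSymm, dotProduct_smul, smul_eq_mul, mul_left_comm, mul_smul, smul_comm,
      smul_sub]

theorem map_comp_orthSymm {B Φ : Type*} [CommRing B] [FunLike Φ A B] [RingHomClass Φ A B]
    (φ : Φ) (t v : Fin 3 → A) : φ ∘ orthSymm t v = orthSymm (φ ∘ t) (φ ∘ v) := by
  funext i
  fin_cases i <;> simp [orthSymm_apply, map_ofNat φ 2]

theorem derivation_comp_orthSymm {k : Type*} [CommRing k] [Algebra k A] {D : Derivation k A A}
    {t : Fin 3 → A} (ht : D ∘ t = 0) (v : Fin 3 → A) :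
    D ∘ orthSymm t v = orthSymm t (D ∘ v) := by
  have h : ∀ i, D (t i) = 0 := congrFun ht
  funext i
  fin_cases i <;> simp [orthSymm_apply, h, two_mul] <;> ring

theorem cross_orthSymm_dotProduct (x t s : Fin 3 → A) :
    (x ⨯₃ orthSymm t s) ⬝ᵥ s = -2 * (t ⬝ᵥ s) * ((x ⨯₃ ![t 0, t 1, 0]) ⬝ᵥ s) := by
  simp only [dotProduct, cross_apply, orthSymm_apply, Fin.sum_univ_three, Matrix.cons_val]
  ring

theorem dotProduct_cross_orthSymm_of_tangent {x t : Fin 3 → A} (h : x ⬝ᵥ t = 0) (s : Fin 3 → A) :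
    ![-t 1, t 0, 0] ⬝ᵥ (x ⨯₃ orthSymm t s) = -x 2 * (t 0 ^ 2 + t 1 ^ 2) * (t ⬝ᵥ s) := by
  simp only [dotProduct, Fin.sum_univ_three] at h
  simp only [dotProduct, cross_apply, orthSymm_apply, Fin.sum_univ_three, Matrix.cons_val]
  linear_combination (-s 2 * (t 0 ^ 2 + t 1 ^ 2)) * h

theorem cross_orthSymm_cross_eq_zero {x t s w l : Fin 3 → A} (hxt : x ⬝ᵥ t = 0)
    (hl : ∀ v, l ⬝ᵥ v + w ⬝ᵥ (x ⨯₃ orthSymm t v) = 0) : ((x ⨯₃ orthSymm t s) ⨯₃ l) ⨯₃ x = 0 := by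
  have hlx : l ⬝ᵥ x = 0 := by
    simpa [orthSymm_of_dotProduct_eq_zero (dotProduct_comm x t ▸ hxt)] using hl x
  rw [cross_cross_eq_smul_sub_smul, hlx, dotProduct_comm, dot_self_cross, zero_smul, zero_smul,
    sub_zero]

theorem cross_orthSymm_cross_ne_zero [IsDomain A] [CharZero A] {k : Type*} [CommRing k]
    [Algebra k A] {x t s w l : Fin 3 → A} (hxt : x ⬝ᵥ t = 0) (hx : x 2 ≠ 0)
    (hN : t 0 ^ 2 + t 1 ^ 2 ≠ 0) (hts : t ⬝ᵥ s ≠ 0) (hns : (x ⨯₃ ![t 0, t 1, 0]) ⬝ᵥ s ≠ 0)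
    (hw : w ≠ 0) (hl : ∀ v, l ⬝ᵥ v + w ⬝ᵥ (x ⨯₃ orthSymm t v) = 0) {D : Derivation k A A}
    (hDx : D ∘ x = ![-t 1, t 0, 0]) (hwρ : w ⬝ᵥ (x ⨯₃ orthSymm t s) = 0)
    (hwDρ : w ⬝ᵥ (D ∘ (x ⨯₃ orthSymm t s)) = 0) :
    (x ⨯₃ orthSymm t s) ⨯₃ l ≠ 0 := by
  intro h0
  have hρs : (x ⨯₃ orthSymm t s) ⬝ᵥ s ≠ 0 := by
    rw [cross_orthSymm_dotProduct]
    exact mul_ne_zero (mul_ne_zero (neg_ne_zero.2 two_ne_zero) hts) hns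
  have hl0 : l = 0 := by
    have hls : l ⬝ᵥ s = 0 := by simpa [hwρ] using hl s
    have h := cross_cross_eq_smul_sub_smul (x ⨯₃ orthSymm t s) l s
    rw [h0, hls, zero_smul, sub_zero, map_zero, LinearMap.zero_apply, eq_comm] at h
    exact (smul_eq_zero.1 h).resolve_left hρs
  have hwx : w ⨯₃ x = 0 := dotProduct_eq_zero _ fun v => by
    have h := hl (orthSymm t v)
    rw [hl0, orthSymm_orthSymm, zero_dotProduct, zero_add, map_smul, dotProduct_smul,
      triple_product_permutation, triple_product_permutation, smul_eq_zero, dotProduct_comm] at h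
    exact h.resolve_left (pow_ne_zero 2 hN)
  have hxDρ : x ⬝ᵥ (D ∘ (x ⨯₃ orthSymm t s)) = 0 :=
    dotProduct_eq_zero_of_cross_eq_zero hw hwx hwDρ
  have hDxρ : (D ∘ x) ⬝ᵥ (x ⨯₃ orthSymm t s) = 0 := by
    have h := derivation_dotProduct D x (x ⨯₃ orthSymm t s)
    rwa [dot_self_cross, map_zero, hxDρ, add_zero, eq_comm] at h
  rw [hDx, dotProduct_cross_orthSymm_of_tangent hxt] at hDxρ
  exact mul_ne_zero (mul_ne_zero (neg_ne_zero.2 hx) hN) hts hDxρ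

end OrthSymm

section Families

variable {σ τ k : Type*} [Field k]

theorem prime_map_C {F : MvPolynomial σ k} (hF : Prime F) :
    Prime (map C F : MvPolynomial σ (MvPolynomial τ k)) := by
  rw [← commAlgEquiv_C, MulEquiv.prime_iff, prime_C_iff]
  exact hF

theorem eval_map_eval_commAlgEquiv (s : τ → k) (z : σ → k)
    (K : MvPolynomial σ (MvPolynomial τ k)) :
    eval s (map (eval z) (commAlgEquiv k σ τ K)) = eval z (map (eval s) K) := by
  induction K using MvPolynomial.induction_on with
  | C a => rw [commAlgEquiv_C, map_map, map_C, eval_C,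
    show (eval z).comp C = RingHom.id k from RingHom.ext (eval_C (f := z)), map_id]
  | add p q hp hq => simp [hp, hq]
  | mul_X p i hp => simp [hp]

theorem map_eval_map_C (s : τ → k) (F : MvPolynomial σ k) : map (eval s) (map C F) = F := by
  rw [map_map, show (eval s).comp C = RingHom.id k from RingHom.ext (eval_C (f := s)), map_id]

theorem not_map_C_dvd_of_not_dvd {F : MvPolynomial σ k} {K : MvPolynomial σ (MvPolynomial τ k)}
    (s : τ → k) (h : ¬ F ∣ map (eval s) K) : ¬ map C F ∣ K := fun hK =>
  h (map_eval_map_C s F ▸ map_dvd (map (eval s)) hK)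

theorem isHomogeneous_of_forall_map_eval [Infinite k] {n : ℕ}
    {K : MvPolynomial σ (MvPolynomial τ k)} (h : ∀ s, (map (eval s) K).IsHomogeneous n) :
    K.IsHomogeneous n := by
  intro m hm
  obtain ⟨s, hs⟩ : ∃ s, eval s (coeff m K) ≠ 0 := by
    by_contra! hc
    exact hm (MvPolynomial.funext fun s => by rw [hc s, map_zero])
  exact h s (by rwa [coeff_map])

/-- `P` holds for all `s` outside a hypersurface. -/
def HoldsGenerically (P : (τ → k) → Prop) : Prop :=
  ∃ G : MvPolynomial τ k, G ≠ 0 ∧ ∀ s, eval s G ≠ 0 → P s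

theorem HoldsGenerically.and {P Q : (τ → k) → Prop} (hP : HoldsGenerically P)
    (hQ : HoldsGenerically Q) : HoldsGenerically fun s => P s ∧ Q s := by
  obtain ⟨G, hG, hGP⟩ := hP
  obtain ⟨H, hH, hHQ⟩ := hQ
  refine ⟨G * H, mul_ne_zero hG hH, fun s hs => ?_⟩
  rw [map_mul] at hs
  exact ⟨hGP s (left_ne_zero_of_mul hs), hHQ s (right_ne_zero_of_mul hs)⟩

theorem holdsGenerically_not_dvd [Finite σ] [IsAlgClosed k] {F : MvPolynomial σ k} (hF : Prime F)
    {K : MvPolynomial σ (MvPolynomial τ k)} (hK : ¬ map C F ∣ K) :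
    HoldsGenerically fun s => ¬ F ∣ map (eval s) K := by
  rw [← commAlgEquiv_C, ← map_dvd_iff (commAlgEquiv k σ τ)] at hK
  have hinv : commAlgEquiv k σ τ (commAlgEquiv k τ σ (C F)) = C F :=
    (commAlgEquiv k τ σ).symm_apply_apply (C F)
  rw [hinv, C_dvd_iff_dvd_coeff] at hK
  push Not at hK
  obtain ⟨m, hm⟩ := hK
  obtain ⟨z, hzF, hz⟩ := exists_eval_eq_zero_of_not_dvd hF hm
  refine ⟨map (eval z) (commAlgEquiv k σ τ K), fun h => hz ?_, fun s hs hdvd => hs ?_⟩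
  · rw [← coeff_map, h, coeff_zero]
  · rw [eval_map_eval_commAlgEquiv]
    exact zero_dvd_iff.1 (hzF ▸ map_dvd (eval z) hdvd)

end Families

section TangentDerivation

variable {R : Type*} [CommRing R]

/-- The derivation of the polynomial ring along the tangent field `(-F_y, F_x)` of the curve
`F = 0` in the chart `z = 1`. -/
noncomputable def tangentDerivation (F : MvPolynomial (Fin 3) R) :
    Derivation R (MvPolynomial (Fin 3) R) (MvPolynomial (Fin 3) R) :=
  pderiv 0 F • pderiv 1 - pderiv 1 F • pderiv 0

theorem tangentDerivation_apply (F G : MvPolynomial (Fin 3) R) :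
    tangentDerivation F G = pderiv 0 F * pderiv 1 G - pderiv 1 F * pderiv 0 G := rfl

theorem tangentDerivation_self (F : MvPolynomial (Fin 3) R) : tangentDerivation F F = 0 := by
  rw [tangentDerivation_apply, mul_comm, sub_self]

theorem tangentDerivation_comp_X (F : MvPolynomial (Fin 3) R) :
    tangentDerivation F ∘ X = ![-pderiv 1 F, pderiv 0 F, 0] := by
  funext i
  fin_cases i <;> simp [tangentDerivation_apply, pderiv_X]

end TangentDerivation

/-- The curve `F = 0` over the ring of polynomials in the coordinates of the light position. -/
noncomputable abbrev constantFamily (F : Poly3) : MvPolynomial (Fin 3) Poly3 := map C F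

/-- The reflected lines for an indeterminate light position: the coefficients of these forms are
polynomials in the coordinates of the light position. -/
noncomputable def rhoFamily (F : Poly3) : Fin 3 → MvPolynomial (Fin 3) Poly3 :=
  X ⨯₃ orthSymm (constantFamily ∘ gradPoly F) (C ∘ X)

theorem map_eval_comp_rhoFamily (F : Poly3) (s : Fin 3 → ℂ) :
    map (eval s) ∘ rhoFamily F = rhoCoord F s := by
  have hX : (map (eval s) : MvPolynomial (Fin 3) Poly3 →+* Poly3) ∘ X = X :=
    funext fun i => map_X (eval s) i
  have hgrad : (map (eval s) : MvPolynomial (Fin 3) Poly3 →+* Poly3) ∘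
      (constantFamily ∘ gradPoly F) = gradPoly F := funext fun i => map_eval_map_C s _
  have hC : (map (eval s) : MvPolynomial (Fin 3) Poly3 →+* Poly3) ∘ (C ∘ X) = C ∘ s :=
    funext fun i => by simp
  rw [rhoFamily, map_comp_cross, map_comp_orthSymm, hX, hgrad, hC]
  rfl

theorem isHomogeneous_rhoFamily {F : Poly3} {d : ℕ} (hF : F.IsHomogeneous d) (i : Fin 3) :
    (rhoFamily F i).IsHomogeneous (1 + ((d - 1) + (d - 1))) :=
  isHomogeneous_of_forall_map_eval fun s => by
    rw [← Function.comp_apply (f := map (eval s)), map_eval_comp_rhoFamily]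
    exact isHomogeneous_rhoCoord hF s i

theorem dvd_X_dotProduct_gradPoly {F : Poly3} {d : ℕ} (hF : F.IsHomogeneous d) :
    F ∣ X ⬝ᵥ gradPoly F := by
  have h : X ⬝ᵥ gradPoly F = d • F := hF.sum_X_mul_pderiv
  exact h ▸ ⟨(d : Poly3), by rw [nsmul_eq_mul, mul_comm]⟩

/-- The coordinate ring of the affine cone of the curve `F = 0` over the ring of polynomials in the
coordinates of the light position. -/
abbrev FamilyRing (F : Poly3) : Type := CoordRing (constantFamily F)

/-- The universal point of the curve. -/
noncomputable abbrev universalPoint (F : Poly3) : Fin 3 → FamilyRing F :=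
  restrict (constantFamily F) ∘ X

/-- The tangent to the curve at its universal point. -/
noncomputable abbrev universalTangent (F : Poly3) : Fin 3 → FamilyRing F :=
  restrict (constantFamily F) ∘ constantFamily ∘ gradPoly F

/-- The universal light position. -/
noncomputable abbrev universalLight (F : Poly3) : Fin 3 → FamilyRing F :=
  restrict (constantFamily F) ∘ C ∘ X

/-- The reflected line at the universal point, for the universal light position. -/
noncomputable def universalReflectedLine (F : Poly3) : Fin 3 → FamilyRing F :=
  universalPoint F ⨯₃ orthSymm (universalTangent F) (universalLight F)

/-- The gradient of `H` with respect to the light position, on which its coefficients depend,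
evaluated at `b`. -/
noncomputable def lightGradAt {A : Type*} [CommRing A] [Algebra Poly3 A]
    (H : MvPolynomial (Fin 3) Poly3) (b : Fin 3 → A) : Fin 3 → A :=
  fun j => aeval b (coeffDerivation (pderiv j : Derivation ℂ Poly3 Poly3) H)

theorem restrict_comp_rhoFamily (F : Poly3) :
    restrict (constantFamily F) ∘ rhoFamily F = universalReflectedLine F := by
  rw [rhoFamily, map_comp_cross, map_comp_orthSymm, universalReflectedLine]

theorem restrict_constantFamily_ne_zero {F : Poly3} {K : MvPolynomial (Fin 3) Poly3}
    (s : Fin 3 → ℂ) (h : ¬ F ∣ map (eval s) K) : restrict (constantFamily F) K ≠ 0 :=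
  fun hK => not_map_C_dvd_of_not_dvd s h (restrict_eq_zero_iff.1 hK)

section ReflectedFamily

variable {F : Poly3} {d n : ℕ} {H : MvPolynomial (Fin 3) Poly3}

theorem universalPoint_dotProduct_universalTangent (hF : F.IsHomogeneous d) :
    universalPoint F ⬝ᵥ universalTangent F = 0 := by
  have h : constantFamily F ∣ X ⬝ᵥ (constantFamily ∘ gradPoly F) := by
    have := map_dvd (map C : Poly3 →+* MvPolynomial (Fin 3) Poly3) (dvd_X_dotProduct_gradPoly hF)
    rwa [RingHom.map_dotProduct, show (map C : Poly3 →+* MvPolynomial (Fin 3) Poly3) ∘ X = X from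
      funext fun i => map_X C i] at this
  rw [← restrict_eq_zero_iff] at h
  rw [← h]
  exact (RingHom.map_dotProduct (restrict (constantFamily F)).toRingHom _ _).symm

theorem exists_derivation_universalLight (v : Fin 3 → FamilyRing F) :
    ∃ D : Derivation ℂ (FamilyRing F) (FamilyRing F),
      D ∘ universalPoint F = 0 ∧ D ∘ universalTangent F = 0 ∧ D ∘ universalLight F = v ∧
      ∀ H b, D (aeval b H) = lightGradAt H b ⬝ᵥ v + gradAt H b ⬝ᵥ (D ∘ b) := by
  have hconst (j : Fin 3) (G : Poly3) :
      coeffDerivation (pderiv j : Derivation ℂ Poly3 Poly3) (constantFamily G) = 0 :=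
    coeffDerivation_map_algebraMap _ G
  choose D hD using fun j : Fin 3 => exists_derivation_restrict (F := constantFamily F)
    (coeffDerivation (pderiv j : Derivation ℂ Poly3 Poly3)) (hconst j F ▸ dvd_zero _)
  let E := v 0 • D 0 + v 1 • D 1 + v 2 • D 2
  have hE (a : FamilyRing F) : E a = v 0 * D 0 a + v 1 * D 1 a + v 2 * D 2 a := rfl
  refine ⟨E, funext fun i => ?_, funext fun i => ?_, funext fun i => ?_, fun H b => ?_⟩
  · simp only [Function.comp_apply, hE, hD, coeffDerivation_X, map_zero, mul_zero, add_zero,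
      Pi.zero_apply]
  · simp only [Function.comp_apply, hE, hD, hconst, map_zero, mul_zero, add_zero, Pi.zero_apply]
  · simp only [Function.comp_apply, hE, hD, coeffDerivation_C]
    fin_cases i <;> simp
  · have hDalg (j : Fin 3) (r : Poly3) : D j (algebraMap Poly3 (FamilyRing F) r) =
        algebraMap Poly3 (FamilyRing F) (pderiv j r) := by
      rw [← (restrict (constantFamily F)).commutes, algebraMap_eq, hD, coeffDerivation_C]
      rfl
    simp only [hE, derivation_aeval (hDalg _), dotProduct, Fin.sum_univ_three,
      Function.comp_apply, lightGradAt]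
    ring

theorem IsMinimalRelation.lightGradAt_dotProduct
    (hH : IsMinimalRelation (universalReflectedLine F) n H) (v : Fin 3 → FamilyRing F) :
    lightGradAt H (universalReflectedLine F) ⬝ᵥ v + gradAt H (universalReflectedLine F) ⬝ᵥ
      (universalPoint F ⨯₃ orthSymm (universalTangent F) v) = 0 := by
  obtain ⟨D, hDx, hDt, hDs, hD⟩ := exists_derivation_universalLight v
  have h := hD H (universalReflectedLine F)
  rwa [hH.aeval_eq_zero, map_zero, universalReflectedLine, derivation_comp_cross, hDx,
    derivation_comp_orthSymm hDt, hDs, map_zero, LinearMap.zero_apply, zero_add, eq_comm] at h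

theorem IsMinimalRelation.cross_lightGradAt_cross (hF : F.IsHomogeneous d)
    (hH : IsMinimalRelation (universalReflectedLine F) n H) :
    (universalReflectedLine F ⨯₃ lightGradAt H (universalReflectedLine F)) ⨯₃
      universalPoint F = 0 :=
  cross_orthSymm_cross_eq_zero (universalPoint_dotProduct_universalTangent hF)
    hH.lightGradAt_dotProduct

theorem exists_derivation_universalPoint (F : Poly3) :
    ∃ D : Derivation Poly3 (FamilyRing F) (FamilyRing F),
      D ∘ universalPoint F = ![-universalTangent F 1, universalTangent F 0, 0] := by
  obtain ⟨D, hD⟩ := exists_derivation_restrict (tangentDerivation (constantFamily F))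
    (tangentDerivation_self (constantFamily F) ▸ dvd_zero _)
  refine ⟨D, funext fun i => ?_⟩
  have h := congrFun (tangentDerivation_comp_X (constantFamily F)) i
  rw [Function.comp_apply] at h
  rw [Function.comp_apply, universalPoint, Function.comp_apply, hD, h]
  fin_cases i <;> simp [pderiv_map, gradPoly]

theorem universalTangent_sq_add_sq_ne_zero (hd : 2 ≤ d) (hF : F.IsHomogeneous d)
    (hFp : Prime F) : universalTangent F 0 ^ 2 + universalTangent F 1 ^ 2 ≠ 0 := by
  have h := restrict_constantFamily_ne_zero
    (K := constantFamily (gradPoly F 0) ^ 2 + constantFamily (gradPoly F 1) ^ 2) 0 (by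
      rw [map_add, map_pow, map_pow, map_eval_map_C, map_eval_map_C]
      exact not_dvd_sq_add_sq hd hF hFp)
  rwa [map_add, map_pow, map_pow] at h

theorem universalTangent_dotProduct_universalLight_ne_zero (hd : 2 ≤ d) (hF : F.IsHomogeneous d)
    (hFp : Prime F) : universalTangent F ⬝ᵥ universalLight F ≠ 0 := by
  have h := restrict_constantFamily_ne_zero
    (K := (constantFamily ∘ gradPoly F) ⬝ᵥ (C ∘ X)) (Pi.single 0 1) (by
      have : ¬ F ∣ gradPoly F 0 := not_dvd_pderiv hd hF hFp 0
      simpa [dotProduct, Fin.sum_univ_three, map_eval_map_C] using this)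
  rwa [dotProduct, map_sum, Finset.sum_congr rfl fun _ _ => map_mul _ _ _] at h

theorem universalNormal_dotProduct_universalLight_ne_zero (hd : 2 ≤ d) (hF : F.IsHomogeneous d)
    (hFp : Prime F) :
    (universalPoint F ⨯₃ ![universalTangent F 0, universalTangent F 1, 0]) ⬝ᵥ
      universalLight F ≠ 0 := by
  have h := restrict_constantFamily_ne_zero
    (K := (X ⨯₃ ![constantFamily (gradPoly F 0), constantFamily (gradPoly F 1), 0]) ⬝ᵥ (C ∘ X))
    (Pi.single 0 1) (by
      have : ¬ F ∣ X 2 * gradPoly F 1 := hFp.not_dvd_mul (not_dvd_X hd hF hFp.ne_zero 2)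
        (not_dvd_pderiv hd hF hFp 1)
      simpa [cross_apply, dotProduct, Fin.sum_univ_three, map_eval_map_C] using this)
  simp only [cross_apply, dotProduct, Fin.sum_univ_three, Matrix.cons_val, map_add, map_sub,
    map_mul, map_zero] at h ⊢
  exact h

theorem IsMinimalRelation.cross_lightGradAt_ne_zero (hd : 2 ≤ d) (hF : F.IsHomogeneous d)
    (hFp : Prime F) (hH : IsMinimalRelation (universalReflectedLine F) n H) :
    universalReflectedLine F ⨯₃ lightGradAt H (universalReflectedLine F) ≠ 0 := by
  have := isDomain_coordRing (F := constantFamily F) (prime_map_C hFp)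
  have := faithfulSMul_coordRing (F := constantFamily F) (by omega) (hF.map C)
    (prime_map_C hFp).ne_zero
  have : CharZero (FamilyRing F) :=
    charZero_of_injective_algebraMap (FaithfulSMul.algebraMap_injective Poly3 (FamilyRing F))
  have hx : universalPoint F 2 ≠ 0 := restrict_constantFamily_ne_zero 0
    ((map_X (eval (0 : Fin 3 → ℂ)) _).symm ▸ not_dvd_X hd hF hFp.ne_zero 2)
  obtain ⟨D, hD⟩ := exists_derivation_universalPoint F
  exact cross_orthSymm_cross_ne_zero (universalPoint_dotProduct_universalTangent hF) hx
    (universalTangent_sq_add_sq_ne_zero hd hF hFp)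
    (universalTangent_dotProduct_universalLight_ne_zero hd hF hFp)
    (universalNormal_dotProduct_universalLight_ne_zero hd hF hFp) hH.gradAt_ne_zero
    hH.lightGradAt_dotProduct hD hH.dotProduct_self (hH.dotProduct_derivation D)

end ReflectedFamily

theorem map_eval_aeval_rhoFamily (F : Poly3) (s : Fin 3 → ℂ) (H : MvPolynomial (Fin 3) Poly3) :
    map (eval s) (aeval (rhoFamily F) H) = aeval (rhoCoord F s) (map (eval s) H) := by
  rw [← map_eval_comp_rhoFamily]
  exact map_bind₁ (eval s) (rhoFamily F) H

theorem restrict_comp_lightGradAt_rhoFamily (F : Poly3) (H : MvPolynomial (Fin 3) Poly3) :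
    restrict (constantFamily F) ∘ lightGradAt H (rhoFamily F) =
      lightGradAt H (universalReflectedLine F) := by
  rw [← restrict_comp_rhoFamily]
  exact funext fun j => restrict_aeval _ _

theorem map_eval_comp_rhoFamily_cross_lightGradAt (F : Poly3) (s : Fin 3 → ℂ)
    (H : MvPolynomial (Fin 3) Poly3) :
    map (eval s) ∘ (rhoFamily F ⨯₃ lightGradAt H (rhoFamily F)) =
      aeval (rhoCoord F s) ∘ (X ⨯₃ fun j =>
        map (eval s) (coeffDerivation (pderiv j : Derivation ℂ Poly3 Poly3) H)) := by
  have hlight : map (eval s) ∘ lightGradAt H (rhoFamily F) = aeval (rhoCoord F s) ∘ fun j =>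
      map (eval s) (coeffDerivation (pderiv j : Derivation ℂ Poly3 Poly3) H) :=
    funext fun _ => map_eval_aeval_rhoFamily F s _
  have hX : aeval (R := ℂ) (rhoCoord F s) ∘ X = rhoCoord F s := funext (aeval_X _)
  rw [map_comp_cross, map_comp_cross, map_eval_comp_rhoFamily, hlight, hX]

theorem holdsGenerically_rationallyDetermines {F : Poly3} {d : ℕ} (hd : 2 ≤ d)
    (hF : F.IsHomogeneous d) (hFp : Prime F) :
    HoldsGenerically fun s : Fin 3 → ℂ =>
      RationallyDetermines ℂ (restrict F ∘ rhoCoord F s) (restrict F ∘ X) := by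
  obtain ⟨n, H, hH⟩ := exists_isMinimalRelation_restrict (F := constantFamily F)
    (by omega) (hF.map C) (prime_map_C hFp) (by omega) (isHomogeneous_rhoFamily hF)
  rw [restrict_comp_rhoFamily] at hH
  let K := rhoFamily F ⨯₃ lightGradAt H (rhoFamily F)
  have hK : restrict (constantFamily F) ∘ K =
      universalReflectedLine F ⨯₃ lightGradAt H (universalReflectedLine F) := by
    rw [← restrict_comp_lightGradAt_rhoFamily, ← restrict_comp_rhoFamily]
    exact map_comp_cross _ _ _
  have hKX : restrict (constantFamily F) ∘ (K ⨯₃ X) = 0 := by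
    rw [← hH.cross_lightGradAt_cross hF, ← hK]
    exact map_comp_cross _ _ _
  obtain ⟨i, hi⟩ := Function.ne_iff.1 (hK ▸ hH.cross_lightGradAt_ne_zero hd hF hFp)
  obtain ⟨G, hG, hGs⟩ := holdsGenerically_not_dvd hFp fun h => hi (restrict_eq_zero_iff.2 h)
  refine ⟨G, hG, fun s hs => ?_⟩
  let g := X ⨯₃ fun j => map (eval s) (coeffDerivation (pderiv j : Derivation ℂ Poly3 Poly3) H)
  have hgs : aeval (restrict F ∘ rhoCoord F s) ∘ g = restrict F ∘ map (eval s) ∘ K := by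
    rw [map_eval_comp_rhoFamily_cross_lightGradAt]
    funext j
    exact (restrict_aeval _ _).symm
  refine ⟨1 + n, g, isHomogeneous_cross (fun j => isHomogeneous_X ℂ j) fun j =>
    (isHomogeneous_coeffDerivation hH.isHomogeneous).map _, ?_, ?_⟩
  · rw [hgs]
    intro h
    have hKi := congrFun h i
    exact hGs s hs (restrict_eq_zero_iff.1 hKi)
  · have hX : map (eval s) ∘ X = (X : Fin 3 → Poly3) := funext (map_X _)
    rw [hgs, ← map_comp_cross, ← hX, ← map_comp_cross]
    exact funext fun j => restrict_eq_zero_iff.2 <|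
      map_eval_map_C s F ▸ map_dvd (map (eval s)) (restrict_eq_zero_iff.1 (congrFun hKX j))

theorem isLinearMap_rhoCoord (F : Poly3) : IsLinearMap ℂ (rhoCoord F) where
  map_add s t := by
    have h : (fun i => C ((s + t) i) : Fin 3 → Poly3) = C ∘ s + C ∘ t := funext fun i => C_add
    rw [rhoCoord, h, (isLinearMap_orthSymm _).map_add, map_add]
    rfl
  map_smul c s := by
    have h : (fun i => C ((c • s) i) : Fin 3 → Poly3) = (C c : Poly3) • C ∘ s :=
      funext fun i => C_mul
    rw [rhoCoord, h, (isLinearMap_orthSymm _).map_smul, map_smul, rhoCoord]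
    exact funext fun i => C_mul'

theorem eval_linForm_apply_single {σ k : Type*} [Field k] [Fintype σ] [DecidableEq σ]
    (f : (σ → k) →ₗ[k] k) (z : σ → k) : eval z (linForm fun i => f (Pi.single i 1)) = f z := by
  rw [eval_linForm, dotProduct]
  conv_rhs => rw [pi_eq_sum_univ' z, map_sum]
  simp_rw [map_smul, smul_eq_mul]

theorem holdsGenerically_linearIndependent {k V ι τ : Type*} [Field k] [AddCommGroup V]
    [Module k V] [Finite ι] [Finite τ] (f : (τ → k) →ₗ[k] ι → V) {s₀ : τ → k}
    (h : LinearIndependent k (f s₀)) : HoldsGenerically fun s => LinearIndependent k (f s) := by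
  classical
  have := Fintype.ofFinite ι
  have := Fintype.ofFinite τ
  obtain ⟨L, hL⟩ := (Fintype.linearCombination k (f s₀)).exists_leftInverse_of_injective
    (LinearMap.ker_eq_bot.2 h.fintypeLinearCombination_injective)
  let l (i j : ι) : (τ → k) →ₗ[k] k := LinearMap.proj j ∘ₗ L ∘ₗ LinearMap.proj i ∘ₗ f
  let M : Matrix ι ι (MvPolynomial τ k) :=
    .of fun i j => linForm fun m => l i j (Pi.single m 1)
  have hM (s : τ → k) : (eval s).mapMatrix M = .of (L ∘ f s) := by
    ext i j
    exact eval_linForm_apply_single (l i j) s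
  have hdet (s : τ → k) : eval s M.det = (Matrix.of (L ∘ f s)).det := by
    rw [RingHom.map_det, hM]
  refine ⟨M.det, fun h0 => ?_, fun s hs => ?_⟩
  · have hone : (Matrix.of (L ∘ f s₀)) = 1 := by
      ext i j
      have := congrFun (LinearMap.congr_fun hL (Pi.single i 1)) j
      simpa [Matrix.one_apply, Pi.single_apply, eq_comm] using this
    have := hdet s₀
    rw [h0, hone, map_zero, Matrix.det_one] at this
    exact zero_ne_one this
  · rw [hdet] at hs
    exact (Matrix.linearIndependent_rows_of_det_ne_zero hs).of_comp L

theorem eval_dotProduct_C {σ k : Type*} [Fintype σ] [CommRing k] (u : σ → MvPolynomial σ k)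
    (v z : σ → k) : eval z (u ⬝ᵥ (C ∘ v)) = (eval z ∘ u) ⬝ᵥ v := by
  simp [dotProduct]

theorem dotProduct_eval_gradPoly {F : Poly3} {d : ℕ} (hF : F.IsHomogeneous d)
    {z : Fin 3 → ℂ} (hz : eval z F = 0) : z ⬝ᵥ (eval z ∘ gradPoly F) = 0 := by
  have h := map_dvd (eval z) (dvd_X_dotProduct_gradPoly hF)
  rw [hz, zero_dvd_iff, RingHom.map_dotProduct] at h
  simpa [dotProduct] using h

theorem eval_comp_rhoCoord (F : Poly3) (s z : Fin 3 → ℂ) :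
    eval z ∘ rhoCoord F s = z ⨯₃ orthSymm (eval z ∘ gradPoly F) s := by
  have hX : eval z ∘ X = z := funext fun i => eval_X i
  have hC : eval z ∘ (fun i => C (s i) : Fin 3 → Poly3) = s := funext fun i => by simp
  rw [rhoCoord, map_comp_cross, map_comp_orthSymm, hX, hC]

/-- When the light position `s` lies on the tangent `t`, the reflected line is the tangent. -/
theorem dotProduct_eq_zero_of_dotProduct_cross_orthSymm {A : Type*} [CommRing A] [IsDomain A]
    {x t s c t' : Fin 3 → A} (hxt : x ⬝ᵥ t = 0) (hts : t ⬝ᵥ s = 0) (ht : t 0 ^ 2 + t 1 ^ 2 ≠ 0)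
    (hs : s ≠ 0) (hst' : s ⬝ᵥ t' = 0) (hxt' : x ⬝ᵥ t' ≠ 0)
    (hc : (x ⨯₃ orthSymm t s) ⬝ᵥ c = 0) : t ⬝ᵥ c = 0 := by
  have hxs : x ⨯₃ s ≠ 0 := fun h =>
    hxt' (dotProduct_eq_zero_of_cross_eq_zero hs (cross_eq_zero_comm.1 h) hst')
  rw [orthSymm_of_dotProduct_eq_zero hts, map_smul, smul_dotProduct] at hc
  refine dotProduct_eq_zero_of_cross_eq_zero hxs ?_ ((smul_eq_zero.1 hc).resolve_left ht)
  rw [cross_cross_eq_smul_sub_smul, hxt, dotProduct_comm, hts, zero_smul, zero_smul, sub_zero]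

theorem exists_tangents_dotProduct_cross_ne_zero {F : Poly3} {d : ℕ} (hd : 2 ≤ d)
    (hF : F.IsHomogeneous d) (hFp : Prime F) {a : Fin 3 → ℂ} (ha : a ≠ 0) :
    ∃ x y, eval x F = 0 ∧ eval y F = 0 ∧ eval x (gradPoly F 0 ^ 2 + gradPoly F 1 ^ 2) ≠ 0 ∧
      eval y (gradPoly F 0 ^ 2 + gradPoly F 1 ^ 2) ≠ 0 ∧ x ⬝ᵥ (eval y ∘ gradPoly F) ≠ 0 ∧
      y ⬝ᵥ (eval x ∘ gradPoly F) ≠ 0 ∧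
      a ⬝ᵥ ((eval x ∘ gradPoly F) ⨯₃ (eval y ∘ gradPoly F)) ≠ 0 := by
  have hN := not_dvd_sq_add_sq hd hF hFp
  obtain ⟨u, hu, hua⟩ := exists_ne_zero_dotProduct_eq_zero a
  obtain ⟨x, hxF, hx⟩ := exists_eval_eq_zero_of_not_dvd hFp <| hFp.not_dvd_mul
    (hFp.not_dvd_mul (not_dvd_X hd hF hFp.ne_zero 2) hN) (not_dvd_polar hd hF hFp hu)
  rw [map_mul, map_mul, eval_X, eval_dotProduct_C] at hx
  have hx0 : x ≠ 0 := fun h => left_ne_zero_of_mul (left_ne_zero_of_mul hx) (congrFun h 2)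
  have hxN := right_ne_zero_of_mul (left_ne_zero_of_mul hx)
  have hax : a ⨯₃ (eval x ∘ gradPoly F) ≠ 0 := fun h => right_ne_zero_of_mul hx <|
    dotProduct_eq_zero_of_cross_eq_zero ha h (by rw [dotProduct_comm, hua])
  have htx : eval x ∘ gradPoly F ≠ 0 := fun h => hax (by rw [h, map_zero])
  obtain ⟨y, hyF, hy⟩ := exists_eval_eq_zero_of_not_dvd hFp <| hFp.not_dvd_mul (hFp.not_dvd_mul hN
    (not_dvd_linForm hd hF hFp.ne_zero htx)) (hFp.not_dvd_mul (not_dvd_polar hd hF hFp hx0)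
    (not_dvd_polar hd hF hFp hax))
  simp only [map_mul, eval_linForm, eval_dotProduct_C, mul_ne_zero_iff] at hy
  refine ⟨x, y, hxF, hyF, hxN, hy.1.1, ?_, hy.1.2, ?_⟩
  · rw [dotProduct_comm]
    exact hy.2.1
  · rw [← triple_product_permutation]
    exact hy.2.2

theorem linearIndependent_restrict_comp_iff {σ ι k : Type*} [Fintype ι] [CommRing k]
    {F : MvPolynomial σ k} {f : ι → MvPolynomial σ k} :
    LinearIndependent k (restrict F ∘ f) ↔ ∀ c : ι → k, F ∣ f ⬝ᵥ (C ∘ c) → c = 0 := by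
  have h (c : ι → k) : ∑ i, c i • (restrict F ∘ f) i = restrict F (f ⬝ᵥ (C ∘ c)) := by
    simp_rw [dotProduct, map_sum, Function.comp_apply, mul_comm (f _), C_mul', map_smul]
  simp only [Fintype.linearIndependent_iff, h, restrict_eq_zero_iff, funext_iff, Pi.zero_apply]

theorem not_dvd_rhoCoord_dotProduct_self {F : Poly3} {d : ℕ} (hd : 2 ≤ d) (hF : F.IsHomogeneous d)
    (hFp : Prime F) {s : Fin 3 → ℂ} (hs : s ≠ 0)
    (hns : ¬ F ∣ (X ⨯₃ ![gradPoly F 0, gradPoly F 1, 0]) ⬝ᵥ (C ∘ s)) :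
    ¬ F ∣ rhoCoord F s ⬝ᵥ (C ∘ s) := by
  have h2 : (-2 : Poly3) = C (-2) := by rw [C_neg, map_ofNat]
  have hident : rhoCoord F s ⬝ᵥ (C ∘ s) = -2 * (gradPoly F ⬝ᵥ (C ∘ s)) *
      ((X ⨯₃ ![gradPoly F 0, gradPoly F 1, 0]) ⬝ᵥ (C ∘ s)) :=
    cross_orthSymm_dotProduct X (gradPoly F) (C ∘ s)
  rw [hident, h2]
  refine hFp.not_dvd_mul (hFp.not_dvd_mul ?_ (not_dvd_polar hd hF hFp hs)) hns
  exact not_dvd_of_isHomogeneous_of_lt hF hFp.ne_zero (isHomogeneous_C _ _) (by simp) (by omega)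

theorem exists_eval_normal_ne_zero {F : Poly3} {d : ℕ} (hd : 2 ≤ d) (hF : F.IsHomogeneous d)
    (hFp : Prime F) : ∃ w, eval w F = 0 ∧
      eval w ∘ ((X : Fin 3 → Poly3) ⨯₃ ![gradPoly F 0, gradPoly F 1, 0]) ≠ 0 := by
  obtain ⟨w, hwF, hw⟩ := exists_eval_eq_zero_of_not_dvd hFp <| hFp.not_dvd_mul
    (not_dvd_X hd hF hFp.ne_zero 2) (not_dvd_pderiv hd hF hFp 1)
  refine ⟨w, hwF, fun h => hw ?_⟩
  simpa [cross_apply, gradPoly] using congrFun h 0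

theorem exists_linearIndependent_rhoCoord {F : Poly3} {d : ℕ} (hd : 2 ≤ d)
    (hF : F.IsHomogeneous d) (hFp : Prime F) :
    ∃ s, LinearIndependent ℂ (restrict F ∘ rhoCoord F s) := by
  obtain ⟨w, hwF, hw⟩ := exists_eval_normal_ne_zero hd hF hFp
  obtain ⟨x, y, hxF, hyF, hxN, hyN, hxy, hyx, hws⟩ :=
    exists_tangents_dotProduct_cross_ne_zero hd hF hFp hw
  -- For the light at the intersection of the tangents at `x` and `y`, these tangents are reflected
  -- lines, so the only candidate for a linear relation between the coordinates of `ρ` is the light.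
  set t := eval x ∘ gradPoly F with ht
  set t' := eval y ∘ gradPoly F with ht'
  have hs0 : t ⨯₃ t' ≠ 0 := fun h => hws (by rw [h, dotProduct_zero])
  refine ⟨t ⨯₃ t', linearIndependent_restrict_comp_iff.2 fun c hc => ?_⟩
  have hcz (z : Fin 3 → ℂ) (hz : eval z F = 0) :
      (z ⨯₃ orthSymm (eval z ∘ gradPoly F) (t ⨯₃ t')) ⬝ᵥ c = 0 := by
    rw [← eval_comp_rhoCoord, ← eval_dotProduct_C]
    exact zero_dvd_iff.1 (hz ▸ map_dvd (eval z) hc)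
  have htc : t ⬝ᵥ c = 0 := dotProduct_eq_zero_of_dotProduct_cross_orthSymm
    (dotProduct_eval_gradPoly hF hxF) (dot_self_cross _ _) (by simpa [ht] using hxN) hs0
    (by rw [dotProduct_comm, dot_cross_self]) hxy (hcz x hxF)
  have htc' : t' ⬝ᵥ c = 0 := dotProduct_eq_zero_of_dotProduct_cross_orthSymm
    (dotProduct_eval_gradPoly hF hyF) (dot_cross_self _ _) (by simpa [ht'] using hyN) hs0
    (by rw [dotProduct_comm, dot_self_cross]) hyx (hcz y hyF)
  obtain ⟨a, rfl⟩ : ∃ a : ℂ, c = a • (t ⨯₃ t') := by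
    refine exists_eq_smul_of_cross_eq_zero hs0 ?_
    rw [cross_cross_eq_smul_sub_smul', dotProduct_comm c t', htc', htc, zero_smul, zero_smul,
      sub_zero]
  have hρ := not_dvd_rhoCoord_dotProduct_self hd hF hFp hs0 fun h => hws <| by
    rw [← eval_dotProduct_C]
    exact zero_dvd_iff.1 (hwF ▸ map_dvd (eval w) h)
  have hCa : (C ∘ (a • t ⨯₃ t') : Fin 3 → Poly3) = (C a : Poly3) • C ∘ (t ⨯₃ t') :=
    funext fun i => C_mul
  rw [hCa, dotProduct_smul, smul_eq_mul] at hc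
  suffices ha : a = 0 by rw [ha, zero_smul]
  by_contra ha
  exact hρ ((isUnit_iff_ne_zero.2 ha).map C |>.dvd_mul_left.1 hc)

theorem holdsGenerically_linearIndependent_rhoCoord {F : Poly3} {d : ℕ} (hd : 2 ≤ d)
    (hF : F.IsHomogeneous d) (hFp : Prime F) :
    HoldsGenerically fun s => LinearIndependent ℂ (restrict F ∘ rhoCoord F s) := by
  obtain ⟨s, hs⟩ := exists_linearIndependent_rhoCoord hd hF hFp
  exact holdsGenerically_linearIndependent
    ((restrict F).toLinearMap.compLeft (Fin 3) ∘ₗ (isLinearMap_rhoCoord F).mk') hs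

theorem exists_eval_smul_ne_zero {τ k : Type*} [Field k] [Infinite k] {G : MvPolynomial τ k}
    {n : ℕ} {s : τ → k} (hs : eval s (homogeneousComponent n G) ≠ 0) :
    ∃ c : k, eval (c • s) G ≠ 0 := by
  let f (i : τ) : MvPolynomial Unit k := C (s i) * X ()
  have hf (i : τ) : (f i).IsHomogeneous 1 := isHomogeneous_C_mul_X (s i) ()
  have hval (c : Unit → k) (H : MvPolynomial τ k) : eval c (aeval f H) = eval (c () • s) H := by
    rw [← aeval_eq_eval, ← aeval_eq_eval, comp_aeval_apply]
    congr 2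
    funext i
    simp [f, mul_comm]
  by_contra! h
  have hG : aeval f G = 0 := MvPolynomial.funext fun c => by rw [hval, h, map_zero]
  have hn := homogeneousComponent_aeval one_ne_zero hf G n
  rw [hG, map_zero] at hn
  have h1 := hval 1 (homogeneousComponent n G)
  rw [← hn, map_zero, Pi.one_apply, one_smul] at h1
  exact hs h1.symm

theorem HoldsGenerically.exists_isHomogeneous {τ k : Type*} [Field k] [Infinite k] [Nonempty τ]
    {P : (τ → k) → Prop} (hP : HoldsGenerically P) (hsmul : ∀ (c : k) s, P (c • s) → P s) :
    ∃ (n : ℕ) (K : MvPolynomial τ k), 0 < n ∧ K.IsHomogeneous n ∧ K ≠ 0 ∧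
      ∀ s, eval s K ≠ 0 → P s := by
  obtain ⟨G, hG, hGP⟩ := hP
  obtain ⟨n, hn⟩ : ∃ n, homogeneousComponent n G ≠ 0 := by
    by_contra! h
    rw [← sum_homogeneousComponent G] at hG
    exact hG (Finset.sum_eq_zero fun n _ => h n)
  let i : τ := Classical.arbitrary τ
  refine ⟨n + 1, homogeneousComponent n G * X i, n.succ_pos,
    (homogeneousComponent_isHomogeneous n G).mul (isHomogeneous_X k i),
    mul_ne_zero hn (X_ne_zero i), fun s hs => ?_⟩
  rw [map_mul] at hs
  obtain ⟨c, hc⟩ := exists_eval_smul_ne_zero (left_ne_zero_of_mul hs)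
  exact hsmul c s (hGP _ hc)

theorem eval_smul_of_isHomogeneous {σ R : Type*} [CommRing R] {G : MvPolynomial σ R} {n : ℕ}
    (hG : G.IsHomogeneous n) (c : R) (v : σ → R) : eval (c • v) G = c ^ n * eval v G := by
  simpa only [aeval_eq_eval] using aeval_smul_of_isHomogeneous hG c v

theorem mk_mem_projZeroLocus_iff {v : Fin 3 → ℂ} (hv : v ≠ 0) {n : ℕ} {G : Poly3}
    (hG : G.IsHomogeneous n) : Projectivization.mk ℂ v hv ∈ projZeroLocus G ↔ eval v G = 0 := by
  obtain ⟨c, hc⟩ := Projectivization.exists_smul_eq_mk_rep ℂ v hv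
  have hsmul : eval (c • v) G = (c : ℂ) ^ n * eval v G := eval_smul_of_isHomogeneous hG (c : ℂ) v
  rw [projZeroLocus, Set.mem_ofPred, ← hc, hsmul, mul_eq_zero]
  exact or_iff_right (pow_ne_zero n c.ne_zero)

theorem isZariskiClosed_projZeroLocus {n : ℕ} {G : Poly3} (hG : G.IsHomogeneous n) :
    IsZariskiClosed (projZeroLocus G) :=
  Set.Subset.antisymm (fun _ hp => hp n G hG subset_rfl) fun _ hp _ _ _ h => h hp

namespace PlaneRatMap

variable {f g : PlaneRatMap} {p q : P2}

/-- The polynomial map between affine cones that a rational map of the plane lifts to. -/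
noncomputable def onCone (f : PlaneRatMap) (v : Fin 3 → ℂ) : Fin 3 → ℂ :=
  fun i => eval v (f.coord i)

theorem onCone_smul (f : PlaneRatMap) (c : ℂ) (v : Fin 3 → ℂ) :
    f.onCone (c • v) = c ^ f.deg • f.onCone v := by
  ext i
  exact eval_smul_of_isHomogeneous (f.homogeneous i) c v

theorem eval_aeval_coord (f : PlaneRatMap) (v : Fin 3 → ℂ) (K : Poly3) :
    eval v (aeval f.coord K) = eval (f.onCone v) K := by
  rw [← aeval_eq_eval, comp_aeval_apply]
  rfl

theorem sends_mk_iff {v w : Fin 3 → ℂ} (hv : v ≠ 0) (hw : w ≠ 0) :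
    f.Sends (.mk ℂ v hv) (.mk ℂ w hw) ↔ f.onCone v ≠ 0 ∧ f.onCone v ⨯₃ w = 0 := by
  obtain ⟨c, hc⟩ := Projectivization.exists_smul_eq_mk_rep ℂ v hv
  have hrep : f.onCone (Projectivization.mk ℂ v hv).rep = (c : ℂ) ^ f.deg • f.onCone v := by
    rw [← hc]
    exact f.onCone_smul c v
  have hc' : (c : ℂ) ^ f.deg ≠ 0 := pow_ne_zero _ c.ne_zero
  have hsends : f.Sends (.mk ℂ v hv) (.mk ℂ w hw) ↔ f.onCone (Projectivization.mk ℂ v hv).rep ≠ 0 ∧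
      f.onCone (Projectivization.mk ℂ v hv).rep ⨯₃ w = 0 :=
    ⟨fun ⟨h, h'⟩ => ⟨h, (Projectivization.mk_eq_mk_iff_crossProduct_eq_zero h hw).1 h'⟩,
      fun ⟨h, h'⟩ => ⟨h, (Projectivization.mk_eq_mk_iff_crossProduct_eq_zero h hw).2 h'⟩⟩
  rw [hsends, hrep, smul_ne_zero_iff_right hc', map_smul, LinearMap.smul_apply,
    smul_eq_zero_iff_right hc']

theorem Sends.mem_projZeroLocus_iff (h : f.Sends p q) {n : ℕ} {K : Poly3}
    (hK : K.IsHomogeneous n) : q ∈ projZeroLocus K ↔ p ∈ projZeroLocus (aeval f.coord K) := by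
  obtain ⟨hp, rfl⟩ := h
  rw [mk_mem_projZeroLocus_iff hp hK]
  exact (iff_of_eq (congrArg (· = 0) (f.eval_aeval_coord p.rep K))).symm

theorem Sends.mem_closedImage (h : f.Sends p q) {A : Set P2} (hp : p ∈ A) :
    q ∈ f.closedImage A :=
  fun _ _ _ hsub => hsub ⟨p, hp, h⟩

theorem closedImage_subset_projZeroLocus {A : Set P2} {n : ℕ} {K : Poly3} (hK : K.IsHomogeneous n)
    (h : A ⊆ projZeroLocus (aeval f.coord K)) : f.closedImage A ⊆ projZeroLocus K :=
  fun _ hq => hq n K hK fun _ ⟨_, hp, hs⟩ => (hs.mem_projZeroLocus_iff hK).2 (h hp)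

/-- The product of the `l`-th form of `f` and the `k`-th form of `g ∘ f`; where it does not vanish,
both `f` and `g ∘ f` are defined. -/
noncomputable def exceptional (f g : PlaneRatMap) (k l : Fin 3) : Poly3 :=
  aeval f.coord (g.coord k) * f.coord l

theorem isHomogeneous_exceptional (f g : PlaneRatMap) (k l : Fin 3) :
    (exceptional f g k l).IsHomogeneous (f.deg * g.deg + f.deg) :=
  ((g.homogeneous k).aeval f.coord f.homogeneous).mul (f.homogeneous l)

theorem eval_exceptional (f g : PlaneRatMap) (k l : Fin 3) (v : Fin 3 → ℂ) :
    eval v (exceptional f g k l) = g.onCone (f.onCone v) k * f.onCone v l := by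
  rw [exceptional, map_mul, eval_aeval_coord]
  rfl

theorem exists_sends_sends {k l : Fin 3} (hp : p ∉ projZeroLocus (exceptional f g k l))
    (h : g.onCone (f.onCone p.rep) ⨯₃ p.rep = 0) :
    ∃ q, q ∉ projZeroLocus (exceptional g f l k) ∧ f.Sends p q ∧ g.Sends q p := by
  rw [projZeroLocus, Set.mem_ofPred, eval_exceptional] at hp
  have hk := left_ne_zero_of_mul hp
  have hl := right_ne_zero_of_mul hp
  have hf : f.onCone p.rep ≠ 0 := fun h => hl (congrFun h l)
  obtain ⟨c, hc⟩ := exists_eq_smul_of_cross_eq_zero p.rep_nonzero h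
  have hc0 : c ≠ 0 := by
    rintro rfl
    exact hk (by rw [hc, zero_smul, Pi.zero_apply])
  refine ⟨.mk ℂ _ hf, ?_, ⟨hf, rfl⟩, ?_⟩
  · rw [mk_mem_projZeroLocus_iff hf (isHomogeneous_exceptional g f l k), eval_exceptional]
    refine mul_ne_zero ?_ hk
    rw [hc, onCone_smul]
    exact mul_ne_zero (pow_ne_zero _ hc0) hl
  · have hs := (sends_mk_iff hf p.rep_nonzero).2 ⟨fun h => hk (congrFun h k), h⟩
    rwa [p.mk_rep] at hs

theorem eval_aeval_coord_cross_X (f g : PlaneRatMap) (v : Fin 3 → ℂ) (i : Fin 3) :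
    eval v (((aeval f.coord ∘ g.coord) ⨯₃ X) i) = (g.onCone (f.onCone v) ⨯₃ v) i := by
  have hgf : eval v ∘ (aeval f.coord ∘ g.coord) = g.onCone (f.onCone v) :=
    funext fun i => by rw [Function.comp_apply, Function.comp_apply, eval_aeval_coord, onCone]
  have hX : eval v ∘ X = v := funext fun i => eval_X i
  rw [← Function.comp_apply (f := eval v), map_comp_cross, hgf, hX]

section LeftInverse

variable {A : Set P2} (hgf : ∀ p ∈ A, g.onCone (f.onCone p.rep) ⨯₃ p.rep = 0)
include hgf

theorem closedImage_subset_projZeroLocus_aeval {F : Poly3} {d : ℕ} (hF : F.IsHomogeneous d)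
    (hA : A ⊆ projZeroLocus F) : f.closedImage A ⊆ projZeroLocus (aeval g.coord F) := by
  refine closedImage_subset_projZeroLocus (hF.aeval g.coord g.homogeneous) fun p hp => ?_
  obtain ⟨c, hc⟩ := exists_eq_smul_of_cross_eq_zero p.rep_nonzero (hgf p hp)
  rw [projZeroLocus, Set.mem_ofPred, eval_aeval_coord, eval_aeval_coord, hc,
    eval_smul_of_isHomogeneous hF, hA hp, mul_zero]

theorem onCone_onCone_cross_eq_zero_of_mem_closedImage (hq : q ∈ f.closedImage A) :
    f.onCone (g.onCone q.rep) ⨯₃ q.rep = 0 := by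
  funext i
  have hK : (((aeval g.coord ∘ f.coord) ⨯₃ X) i).IsHomogeneous (g.deg * f.deg + 1) :=
    isHomogeneous_cross (fun j => (f.homogeneous j).aeval g.coord g.homogeneous)
      (fun j => isHomogeneous_X ℂ j) i
  have hvanish : A ⊆ projZeroLocus (aeval f.coord (((aeval g.coord ∘ f.coord) ⨯₃ X) i)) := by
    intro p hp
    obtain ⟨c, hc⟩ := exists_eq_smul_of_cross_eq_zero p.rep_nonzero (hgf p hp)
    rw [projZeroLocus, Set.mem_ofPred, eval_aeval_coord, eval_aeval_coord_cross_X, hc,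
      onCone_smul, map_smul, LinearMap.smul_apply, cross_self, smul_zero, Pi.zero_apply]
  have hq0 : eval q.rep (((aeval g.coord ∘ f.coord) ⨯₃ X) i) = 0 :=
    closedImage_subset_projZeroLocus hK hvanish hq
  rwa [eval_aeval_coord_cross_X] at hq0

end LeftInverse

theorem isBirationalOn_of_leftInverse {F : Poly3} {d : ℕ} (hF : F.IsHomogeneous d)
    (hgf : ∀ p ∈ projZeroLocus F, g.onCone (f.onCone p.rep) ⨯₃ p.rep = 0) {k l : Fin 3}
    (hne : (projZeroLocus F \ projZeroLocus (exceptional f g k l)).Nonempty) :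
    f.IsBirationalOn (projZeroLocus F) := by
  have fwd : ∀ p ∈ projZeroLocus F \ projZeroLocus (exceptional f g k l),
      ∃ q ∈ f.closedImage (projZeroLocus F) \ projZeroLocus (exceptional g f l k),
        f.Sends p q ∧ g.Sends q p := by
    rintro p ⟨hpA, hp⟩
    obtain ⟨q, hq, hpq, hqp⟩ := exists_sends_sends hp (hgf p hpA)
    exact ⟨q, ⟨hpq.mem_closedImage hpA, hq⟩, hpq, hqp⟩
  refine ⟨g, _, _, isZariskiClosed_projZeroLocus (isHomogeneous_exceptional f g k l),
    isZariskiClosed_projZeroLocus (isHomogeneous_exceptional g f l k), hne, ?_, fwd, ?_⟩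
  · obtain ⟨p, hp⟩ := hne
    obtain ⟨q, hq, -⟩ := fwd p hp
    exact ⟨q, hq⟩
  · rintro q ⟨hqA, hq⟩
    obtain ⟨p, hp, hqp, hpq⟩ := exists_sends_sends hq
      (onCone_onCone_cross_eq_zero_of_mem_closedImage hgf hqA)
    have hpF := closedImage_subset_projZeroLocus_aeval hgf hF subset_rfl hqA
    exact ⟨p, ⟨(hqp.mem_projZeroLocus_iff hF).2 hpF, hp⟩, hqp, hpq⟩

theorem isBirationalOn_of_rationallyDetermines {F : Poly3} {d : ℕ} (hd : 2 ≤ d)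
    (hF : F.IsHomogeneous d) (hFp : Prime F) (hf : restrict F ∘ f.coord ≠ 0)
    (h : RationallyDetermines ℂ (restrict F ∘ f.coord) (restrict F ∘ X)) :
    f.IsBirationalOn (projZeroLocus F) := by
  obtain ⟨e, g, hg, hgf0, hgf⟩ := h
  have hcomp : aeval (restrict F ∘ f.coord) ∘ g = restrict F ∘ aeval f.coord ∘ g := by
    ext1 i
    exact (restrict_aeval f.coord (g i)).symm
  rw [hcomp] at hgf0 hgf
  obtain ⟨k, hk⟩ := Function.ne_iff.1 hgf0
  obtain ⟨l, hl⟩ := Function.ne_iff.1 hf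
  let g' : PlaneRatMap := ⟨g, e, hg⟩
  refine isBirationalOn_of_leftInverse (g := g') (k := k) (l := l) hF (fun p hp => ?_) ?_
  · rw [← map_comp_cross] at hgf
    funext i
    have hdvd : F ∣ ((aeval f.coord ∘ g) ⨯₃ X) i := restrict_eq_zero_iff.1 (congrFun hgf i)
    have hp0 : eval p.rep F = 0 := hp
    have hzero : eval p.rep (((aeval f.coord ∘ g) ⨯₃ X) i) = 0 :=
      zero_dvd_iff.1 (hp0 ▸ map_dvd (eval p.rep) hdvd)
    rw [← eval_aeval_coord_cross_X]
    exact hzero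
  · obtain ⟨z, hzF, hz⟩ := exists_eval_eq_zero_of_not_dvd hFp <| hFp.not_dvd_mul
      (hFp.not_dvd_mul (restrict_eq_zero_iff.not.1 hk) (restrict_eq_zero_iff.not.1 hl))
      (not_dvd_X hd hF hFp.ne_zero 0)
    rw [map_mul, eval_X] at hz
    have hz0 : z ≠ 0 := fun h => right_ne_zero_of_mul hz (congrFun h 0)
    exact ⟨.mk ℂ z hz0, (mk_mem_projZeroLocus_iff hz0 hF).2 hzF, fun h => left_ne_zero_of_mul hz
      ((mk_mem_projZeroLocus_iff hz0 (isHomogeneous_exceptional f g' k l)).1 h)⟩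

end PlaneRatMap

theorem restrict_comp_rhoCoord_smul (F : Poly3) (c : ℂ) (s : Fin 3 → ℂ) :
    restrict F ∘ rhoCoord F (c • s) = c • (restrict F ∘ rhoCoord F s) := by
  rw [(isLinearMap_rhoCoord F).map_smul]
  ext1 i
  exact map_smul (restrict F) c _

theorem exists_isHomogeneous_forall_rationallyDetermines {F : Poly3} {d : ℕ} (hd : 2 ≤ d)
    (hF : F.IsHomogeneous d) (hFp : Prime F) :
    ∃ (n : ℕ) (G : Poly3), 0 < n ∧ G.IsHomogeneous n ∧ G ≠ 0 ∧ ∀ s, eval s G ≠ 0 →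
      RationallyDetermines ℂ (restrict F ∘ rhoCoord F s) (restrict F ∘ X) ∧
        LinearIndependent ℂ (restrict F ∘ rhoCoord F s) := by
  have := isDomain_coordRing hFp
  refine ((holdsGenerically_rationallyDetermines hd hF hFp).and
    (holdsGenerically_linearIndependent_rhoCoord hd hF hFp)).exists_isHomogeneous ?_
  rintro c s ⟨hdet, hlin⟩
  rw [restrict_comp_rhoCoord_smul] at hdet hlin
  rw [← algebraMap_smul (CoordRing F) c] at hdet
  exact ⟨hdet.of_smul, .of_comp (LinearMap.lsmul ℂ _ c) hlin⟩

theorem restrict_X_two_ne_zero {F : Poly3} {d : ℕ} (hd : 2 ≤ d) (hF : F.IsHomogeneous d)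
    (hFp : Prime F) : restrict F (X 2) ≠ 0 :=
  fun h => not_dvd_X hd hF hFp.ne_zero 2 (restrict_eq_zero_iff.1 h)

theorem exists_derivation_restrict_phiCoord {F : Poly3} {d : ℕ} (hd : 2 ≤ d)
    (hF : F.IsHomogeneous d) (hFp : Prime F) :
    ∃ D : Derivation ℂ (CoordRing F) (CoordRing F),
      D (restrict F (X 2)) = 0 ∧ D (restrict F (X 0)) ≠ 0 ∧ ∀ s,
        restrict F ∘ phiCoord F s =
          (restrict F ∘ rhoCoord F s) ⨯₃ (D ∘ restrict F ∘ rhoCoord F s) := by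
  obtain ⟨D, hD⟩ := exists_derivation_restrict (F := F) (tangentDerivation F)
    (tangentDerivation_self F ▸ dvd_zero F)
  have hDX (i : Fin 3) :
      D (restrict F (X i)) = restrict F (![-pderiv 1 F, pderiv 0 F, 0] i) :=
    (hD _).trans (congrArg _ (congrFun (tangentDerivation_comp_X F) i))
  refine ⟨D, (hDX 2).trans (map_zero _), ?_, fun s => ?_⟩
  · rw [hDX, Ne, restrict_eq_zero_iff]
    exact (dvd_neg.not).2 (not_dvd_pderiv hd hF hFp 1)
  · rw [phiCoord, map_comp_cross]
    congr 1
    ext1 i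
    exact (hD _).symm

theorem restrict_comp_phiCoord_ne_zero {F : Poly3} {d : ℕ} (hd : 2 ≤ d) (hF : F.IsHomogeneous d)
    (hFp : Prime F) {s : Fin 3 → ℂ} (hlin : LinearIndependent ℂ (restrict F ∘ rhoCoord F s)) :
    restrict F ∘ phiCoord F s ≠ 0 := by
  obtain ⟨D, hD2, hD0, hD⟩ := exists_derivation_restrict_phiCoord hd hF hFp
  exact hD s ▸ cross_derivation_ne_zero (by omega) hF hFp (restrict_X_two_ne_zero hd hF hFp)
    hD2 hD0 (isHomogeneous_rhoCoord hF s) hlin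

theorem rationallyDetermines_phiCoord_rhoCoord {F : Poly3} {d : ℕ} (hd : 2 ≤ d)
    (hF : F.IsHomogeneous d) (hFp : Prime F) {s : Fin 3 → ℂ}
    (hlin : LinearIndependent ℂ (restrict F ∘ rhoCoord F s)) :
    RationallyDetermines ℂ (restrict F ∘ phiCoord F s) (restrict F ∘ rhoCoord F s) := by
  obtain ⟨D, hD2, hD0, hD⟩ := exists_derivation_restrict_phiCoord hd hF hFp
  have hdeg : (phiMap F hF s).deg ≠ 0 := by
    simp only [phiMap]
    omega
  exact rationallyDetermines_of_eq_cross_derivation (by omega) hF hFp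
    (restrict_X_two_ne_zero hd hF hFp) hD2 hD0 (isHomogeneous_rhoCoord hF s) hdeg
    (phiMap F hF s).homogeneous hlin (hD s)

theorem theorem1 (F : Poly3) (d : ℕ) (hd : 2 ≤ d) (hF : F.IsHomogeneous d)
    (hirr : Irreducible F) :
    ∃ (n : ℕ) (G : Poly3), 0 < n ∧ G.IsHomogeneous n ∧ G ≠ 0 ∧
      ∀ (s : Fin 3 → ℂ) (hs : s ≠ 0), Projectivization.mk ℂ s hs ∉ projZeroLocus G →
        (rhoMap F hF s).IsBirationalOn (projZeroLocus F) ∧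
        (phiMap F hF s).IsBirationalOn (projZeroLocus F) := by
  have hFp := hirr.prime
  have := isDomain_coordRing hFp
  obtain ⟨n, G, hn, hG, hG0, hgen⟩ := exists_isHomogeneous_forall_rationallyDetermines hd hF hFp
  refine ⟨n, G, hn, hG, hG0, fun s hs hsG => ?_⟩
  rw [mk_mem_projZeroLocus_iff hs hG] at hsG
  obtain ⟨hρX, hlin⟩ := hgen s hsG
  have hρ0 : restrict F ∘ rhoCoord F s ≠ 0 := fun h => hlin.ne_zero 0 (congrFun h 0)
  have hφ0 := restrict_comp_phiCoord_ne_zero hd hF hFp hlin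
  have hφρ := rationallyDetermines_phiCoord_rhoCoord hd hF hFp hlin
  exact ⟨(rhoMap F hF s).isBirationalOn_of_rationallyDetermines hd hF hFp hρ0 hρX,
    (phiMap F hF s).isBirationalOn_of_rationallyDetermines hd hF hFp hφ0 (hφρ.trans hρX)⟩
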